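/- \textbf{Model.} Fix integers $n\ge 1$ (participants $S=\{P_1,\dots,P_n\}$), $q\ge 0$ (queries each participant may ask the random oracle per round), $R\ge 2$ (recency parameter), and probabilities $0<p<p_f\le 1$. Let $\kappa$ be the security parameter. \emph{Oracle.} The random oracle is idealised: each query names a parent block, a pointer block, a list of fruits and a record, and its answer is, independently of all other queries, successful as a block with probability $p$ and, independently, as a fruit with probability $p_f$; the result bears a unique stamp and its producer's name and cannot be forged. A chain is valid if its non-genesis blocks are successful block queries and every fruit contained in a block is a successful fruit query whose pointer is one of the $R\kappa$ blocks of the chain preceding that block. \emph{Fruitchain protocol.} The execution proceeds in synchronous rounds. In each round every participant following the protocol asks $q$ queries, all extending its local chain, with pointer the block $\kappa$ positions behind the tip (or the genesis block), with the input received from the environment as record, and including all fruits it has received that are recent for its local chain (i.e. whose pointer is one of its last $R\kappa$ blocks) and not yet contained in it; it diffuses every block and fruit found. At the end of the round every participant processes the messages delivered to it: it adopts a valid chain that is strictly longer than its own (among equally long ones it keeps the first received), and stores valid fruits. \emph{Adversary.} A static adversary with fixed cost controls a set $T\subseteq S$ and commits in advance to a number $q-x_m$ of queries, $0\le x_m\le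 q$, which each $P_m\in T$ asks in every round. Otherwise its (randomised) strategy is arbitrary, with no bound on its computing power (so all PPT adversaries are included). It is activated last in each round, sees all messages of the honest participants, and decides which messages each participant receives first and in which order; all remaining honest messages are then delivered by the end of the round, in an arbitrary order. The adversary $H_T$ lets every member of $T$ follow the protocol with all $q$ queries, delivers the solutions of $T$ first, and ignores the messages of the environment. The environment $\mathcal Z$ is an arbitrary randomised machine that gives inputs to the participants and the adversary and receives outputs from them; it runs the protocol for $r=r(\kappa)$ rounds, where $r$ is a non-constant polynomial with $r(\kappa)\ne 0$ for $\kappa\geq 1$ ($r$-admissible). \emph{Utility.} Each fruit gives the constant reward $w_f$ and each query costs $c\ge 0$. For an execution $\mathcal E$ and $P_j\in S\setminus T$, the absolute rewards minus absolute cost are $$U_T^j(\mathcal E)=w_f\cdot\#\{\text{distinct fruits produced by } T \text{ in the local chain of } P_j \text{ after round } r\}-c\cdot\#\{\text{queries asked by } T\},$$ and $U_T^{\max}=\max_{j\in S\setminus T}U_T^j$, $U_T^{\min}=\min_{j\in S\setminus T}U_T^j$. \emph{EVP.} The protocol is a $(t,\epsilon,\epsilon')$-equilibrium with virtual payoffs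 (EVP) if for every $T$ with $|T|\le t$, every $r$ as above, every static adversary $\mathcal A$ with fixed cost controlling $T$, every $r$-admissible environment $\mathcal Z$ and every delivery order, two independent executions $\mathcal E_{\mathcal Z,H_T}$ and $\mathcal E'_{\mathcal Z,\mathcal A}$ with the same environment satisfy $$U_T^{\max}(\mathcal E'_{\mathcal Z,\mathcal A})\le U_T^{\min}(\mathcal E_{\mathcal Z,H_T})+\epsilon\,\bigl|U_T^{\min}(\mathcal E_{\mathcal Z,H_T})\bigr|+\epsilon'$$ with probability $1-\nu(\kappa)$, where $\nu$ is negligible, i.e. $\kappa^d\nu(\kappa)\to 0$ for every $d\in\mathbb N$. \textbf{Theorem.} Assume that $\phi\in(0,1)$ satisfies $c<p_f\cdot w_f\cdot\phi$. Then for every $\delta_1\in(0,0.25)$ with $c\le p_f\cdot w_f\cdot(1-\delta_1)\cdot\phi$ and $4\delta_1<1-\phi$, the Fruitchain protocol in this synchronous setting is an $\left(n-1,\ \frac{4\delta_1}{1-\phi},\ 0\right)$-EVP according to the utility absolute rewards minus absolute cost. -/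

import Mathlib

open MeasureTheory ProbabilityTheory

noncomputable section

namespace Fruitchain

section Objects

open scoped Classical

/-- Outcome of a query to the (idealised) random oracle.  All queries use the same format, so one
query may at the same time yield a block and a fruit.  `parent` is the block that is extended,
`pointer` the block from which a fruit hangs, `fruits` the fruits whose fingerprint is included and
`record` the payload.  The stamp (`miner`, `round`, `slot`) stands for the nonce and the hash value:
different queries have different stamps. -/
inductive Node (n : ℕ) : Type
  | genesis : Node n
  | mined (miner : Fin n) (round slot : ℕ) (isBlock isFruit : Bool)
      (parent pointer : Node n) (fruits : List (Node n)) (record : List Bool) : Node n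

variable {n : ℕ}

namespace Node

/-- The query was successful as a block. -/
def isBlock : Node n → Bool
  | genesis => true
  | mined _ _ _ b _ _ _ _ _ => b

/-- The query was successful as a fruit. -/
def isFruit : Node n → Bool
  | genesis => false
  | mined _ _ _ _ f _ _ _ _ => f

def parent : Node n → Node n
  | genesis => genesis
  | mined _ _ _ _ _ P _ _ _ => P

def pointer : Node n → Node n
  | genesis => genesis
  | mined _ _ _ _ _ _ Q _ _ => Q

def fruits : Node n → List (Node n)
  | genesis => []
  | mined _ _ _ _ _ _ _ F _ => F

/-- `x` was obtained by a query of participant `l`. -/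
def MinedBy (l : Fin n) : Node n → Prop
  | genesis => False
  | mined m _ _ _ _ _ _ _ _ => m = l

/-- The chain ending in a node, listed from the tip back to the genesis block. -/
def chain : Node n → List (Node n)
  | genesis => [genesis]
  | mined m i k b f P Q F rec => mined m i k b f P Q F rec :: P.chain

/-- Length of the chain ending in a node (the genesis block not counted). -/
def height : Node n → ℕ
  | genesis => 0
  | mined _ _ _ _ _ P _ _ _ => P.height + 1

/-- The block `d` positions behind the tip (the genesis block if the chain is too short). -/
def back : ℕ → Node n → Node n
  | 0, B => B
  | d + 1, B => back d B.parent

/-- All fruits contained in the blocks of the chain ending in a node. -/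
def chainFruits (B : Node n) : List (Node n) :=
  B.chain.flatMap fruits

/-- `f` may be included in a block extending `B`: it hangs from one of the last `window` blocks of
the chain ending in `B`. -/
def Recent (window : ℕ) (f B : Node n) : Prop :=
  f.pointer ∈ B.chain ∧ B.height + 1 ≤ f.pointer.height + window

end Node

/-- The content of a query to the random oracle. -/
structure Puzzle (n : ℕ) where
  parent : Node n
  pointer : Node n
  fruits : List (Node n)
  record : List Bool

/-- The node created by the `slot`-th query of participant `m` in a given round, where `ans` tells
whether the query gives a block and whether it gives a fruit. -/
def Puzzle.solve (P : Puzzle n) (m : Fin n) (round slot : ℕ) (ans : Bool × Bool) : Node n :=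
  .mined m round slot ans.1 ans.2 P.parent P.pointer P.fruits P.record

/-- Validity of a chain, checked against the list `log` of all queries made so far: every block
except the genesis block is a successful query, and contains only recent successful fruits. -/
def ValidChain (window : ℕ) (log : List (Node n)) (tip : Node n) : Prop :=
  ∀ B ∈ tip.chain, B ≠ .genesis → B ∈ log ∧ B.isBlock = true ∧
    ∀ f ∈ B.fruits, f ∈ log ∧ f.isFruit = true ∧ f.Recent window B.parent

/-- Local view of a participant that follows the protocol: its local chain, given by the last
block, and the fruits it has received. -/
structure LocalView (n : ℕ) where
  tip : Node n
  known : List (Node n)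

/-- The view at the beginning of the execution. -/
def LocalView.start : LocalView n := ⟨.genesis, []⟩

/-- Processing of one received message.  A chain is adopted if it is valid and strictly longer than
the local chain (so among chains of the same length the first one received is kept), and valid
fruits are stored. -/
def LocalView.receive (window : ℕ) (log : List (Node n)) (v : LocalView n) (x : Node n) :
    LocalView n where
  tip := if ValidChain window log x ∧ v.tip.height < x.height then x else v.tip
  known := if x ∈ log ∧ x.isFruit = true ∧ x ∉ v.known then v.known ++ [x] else v.known

/-- The query prescribed by the protocol: extend the local chain, hang a possible fruit from the
block `depth` positions behind the tip, and include all recent fruits that the local chain does not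
contain yet. -/
def LocalView.puzzle (depth window : ℕ) (v : LocalView n) (record : List Bool) : Puzzle n where
  parent := v.tip
  pointer := v.tip.back depth
  fruits := v.known.filter fun f => f.Recent window v.tip ∧ f ∉ v.tip.chainFruits
  record := record

end Objects

/-- Parameters of the protocol: `n` participants, at most `q` queries per participant and round,
recency parameter `R`, and the probabilities `p` and `pf` with which a query gives a block and a
fruit, respectively. -/
structure Protocol where
  n : ℕ
  q : ℕ
  R : ℕ
  p : unitInterval
  pf : unitInterval

/-- The environment: an interactive randomised machine, given by its transition functions and the
law of its private coins.  In each round it gives an input to each participant and a message to the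
adversary, and it receives the local chains of the honest participants and a message from the
adversary. -/
structure Environment (n : ℕ) where
  State : Type
  coins : PMF ℕ
  start : ℕ → State
  input : State → Fin n → List Bool
  toAdversary : State → List Bool
  finish : State → (outputs : Fin n → Option (Node n)) → (report : List Bool) → State

/-- A static adversary with fixed cost: an interactive randomised machine together with the number
`queries m` of oracle queries which it commits to ask per round through participant `m` of its
coalition.  It is activated at the end of each round, when it sees the messages of the honest
participants; then it asks its queries one after the other; then it chooses which messages are
delivered first, and in which order, to each participant. -/
structure Adversary (n q : ℕ) where
  State : Type
  coins : PMF ℕ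
  start : ℕ → State
  queries : Fin n → ℕ
  queries_le : ∀ m, queries m ≤ q
  /-- Activation with the message of the environment, the inputs of the coalition and the messages
  of the honest participants. -/
  activate : State → List Bool → (Fin n → List Bool) → List (Node n) → State
  ask : State → Fin n → Puzzle n
  answer : State → Node n → State
  deliver : State → Fin n → List (Node n)
  report : State → List Bool
  /-- End of the round: the coalition receives the messages delivered to its members; the list of
  all queries made so far allows it to verify them. -/
  finish : State → (delivered : Fin n → List (Node n)) → (log : List (Node n)) → State

/-- The order in which the messages of honest participants that the adversary did not deliver
itself are delivered to each participant at the end of each round.  It is arbitrary, but every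
message is delivered. -/
structure DeliveryOrder (n : ℕ) where
  order : ℕ → Fin n → List (Node n) → List (Node n)
  perm : ∀ i j l, (order i j l).Perm l

/-- State of an execution between two rounds; `log` lists all oracle queries made so far. -/
structure World {n q : ℕ} (Z : Environment n) (A : Adversary n q) where
  env : Z.State
  adv : A.State
  views : Fin n → LocalView n
  log : List (Node n)

/-- What matters of a complete execution: the local views of the participants after the last round
and the list of all oracle queries. -/
structure Execution (n : ℕ) where
  views : Fin n → LocalView n
  log : List (Node n)

section Execution

variable (Prot : Protocol) (κ : ℕ) (T : Finset (Fin Prot.n)) (D : DeliveryOrder Prot.n)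
  (Z : Environment Prot.n) (A : Adversary Prot.n Prot.q)

/-- The queries of the honest participants in round `i` (in round-robin order), when `ans` gives
the answers of the oracle. -/
def honestQueries (i : ℕ) (ans : Fin Prot.n → Fin Prot.q → Bool × Bool)
    (views : Fin Prot.n → LocalView Prot.n) (input : Fin Prot.n → List Bool) : List (Node Prot.n) :=
  ((List.finRange Prot.n).filter fun j => j ∉ T).flatMap fun j =>
    (List.finRange Prot.q).map fun (k : Fin Prot.q) =>
      ((views j).puzzle κ (Prot.R * κ) (input j)).solve j i k (ans j k)

/-- The queries that the adversary has committed to ask in each round. -/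
def adversarySlots : List (Fin Prot.n × Fin Prot.q) :=
  ((List.finRange Prot.n).filter fun m => m ∈ T).flatMap fun m =>
    ((List.finRange Prot.q).filter fun (k : Fin Prot.q) => k.val < A.queries m).map
      fun k => (m, k)

/-- The adversary asks its queries in round `i`, each depending on the previous answers.  Returns
its new state and the list of its queries. -/
def adversaryQueries (i : ℕ) (ans : Fin Prot.n → Fin Prot.q → Bool × Bool) (a : A.State) :
    A.State × List (Node Prot.n) :=
  (adversarySlots Prot T A).foldl
    (fun s mk =>
      let x := (A.ask s.1 mk.1).solve mk.1 i mk.2 (ans mk.1 mk.2)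
      (A.answer s.1 x, s.2 ++ [x]))
    (a, [])

open scoped Classical in
/-- Round `i` of the execution, with `ans m k` the oracle's answer to the `k`-th query of
participant `m` in this round. -/
def playRound (i : ℕ) (ans : Fin Prot.n → Fin Prot.q → Bool × Bool) (W : World Z A) : World Z A :=
  let input := Z.input W.env
  let hq := honestQueries Prot κ T i ans W.views input
  let sent := hq.filter fun x => x.isBlock = true ∨ x.isFruit = true
  let a := A.activate W.adv (Z.toAdversary W.env) (fun j => if j ∈ T then input j else []) sent
  let aq := adversaryQueries Prot T A i ans a
  let log := W.log ++ hq ++ aq.2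
  let delivered : Fin Prot.n → List (Node Prot.n) := fun j =>
    A.deliver aq.1 j ++ D.order i j (sent.filter fun x => x ∉ A.deliver aq.1 j)
  let views : Fin Prot.n → LocalView Prot.n := fun j =>
    if j ∈ T then W.views j
    else (delivered j).foldl (LocalView.receive (Prot.R * κ) log) (W.views j)
  { env := Z.finish W.env (fun j => if j ∈ T then none else some (views j).tip) (A.report aq.1)
    adv := A.finish aq.1 (fun j => if j ∈ T then delivered j else []) log
    views := views
    log := log }

/-- The randomness of an execution of `r` rounds: coins of the environment, coins of the adversary,
and the answers of the oracle (block?, fruit?). -/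
abbrev Randomness (r : ℕ) : Type :=
  ℕ × ℕ × (Fin r × Fin Prot.n × Fin Prot.q → Bool × Bool)

/-- The execution after its first `i` rounds. -/
def worldAfter {r : ℕ} (ω : Randomness Prot r) : ℕ → World Z A
  | 0 => ⟨Z.start ω.1, A.start ω.2.1, fun _ => .start, []⟩
  | i + 1 => playRound Prot κ T D Z A i
      (fun m k => if h : i < r then ω.2.2 (⟨i, h⟩, m, k) else (false, false)) (worldAfter ω i)

/-- The complete execution of `r` rounds with security parameter `κ`, environment `Z` and an
adversary `A` controlling `T`. -/
def execution {r : ℕ} (ω : Randomness Prot r) : Execution Prot.n :=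
  let W := worldAfter Prot κ T D Z A ω r
  ⟨W.views, W.log⟩

/-- Law of the oracle's answer to a query: a block with probability `p` and, independently, a fruit
with probability `pf`. -/
def answerLaw : Measure (Bool × Bool) :=
  (bernoulliMeasure true false Prot.p).prod (bernoulliMeasure true false Prot.pf)

/-- Law of the randomness of an execution. -/
def randomnessLaw (r : ℕ) : Measure (Randomness Prot r) :=
  Z.coins.toMeasure.prod (A.coins.toMeasure.prod (Measure.pi fun _ => answerLaw Prot))

end Execution

/-- State of the coalition that follows the protocol. -/
structure CoalitionState (n : ℕ) where
  views : Fin n → LocalView n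
  input : Fin n → List Bool
  solved : List (Node n)

open scoped Classical in
/-- The adversary `H_T`: every member of the coalition follows the protocol and asks all its
queries; the solutions found by the coalition are delivered first; messages of the environment are
ignored and not answered. -/
def followProtocol (Prot : Protocol) (κ : ℕ) : Adversary Prot.n Prot.q where
  State := CoalitionState Prot.n
  coins := PMF.pure 0
  start := fun _ => ⟨fun _ => .start, fun _ => [], []⟩
  queries := fun _ => Prot.q
  queries_le := fun _ => le_rfl
  activate := fun s _ input _ => { s with input := input, solved := [] }
  ask := fun s m => (s.views m).puzzle κ (Prot.R * κ) (s.input m)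
  answer := fun s x =>
    if x.isBlock = true ∨ x.isFruit = true then { s with solved := s.solved ++ [x] } else s
  deliver := fun s _ => s.solved
  report := fun _ => []
  finish := fun s delivered log =>
    { s with views := fun m =>
        (delivered m).foldl (LocalView.receive (Prot.R * κ) log) (s.views m) }

/-! ### Rewards, costs, utilities -/

section Payoffs

variable {n : ℕ}

open scoped Classical in
/-- Reward of the coalition `T` in the view of participant `j`: each fruit produced by a member of
`T` and contained in the local chain of `j` gives `wf`. -/
def reward (wf : ℝ) (T : Finset (Fin n)) (j : Fin n) (E : Execution n) : ℝ :=
  wf * (((E.views j).tip.chainFruits.toFinset.filter fun f => ∃ l ∈ T, f.MinedBy l).card : ℝ)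

open scoped Classical in
/-- Cost of participant `l`: each of its oracle queries costs `c`. -/
def cost (c : ℝ) (l : Fin n) (E : Execution n) : ℝ :=
  c * ((E.log.filter fun x => x.MinedBy l).length : ℝ)

/-- Absolute rewards minus absolute cost. -/
def rewardMinusCost (wf c : ℝ) (T : Finset (Fin n)) (j : Fin n) (E : Execution n) : ℝ :=
  reward wf T j E - ∑ l ∈ T, cost c l E

/-- Largest utility of the coalition in the view of a participant outside of it. -/
def utilityMax (U : Finset (Fin n) → Fin n → Execution n → ℝ) (T : Finset (Fin n))
    (E : Execution n) : ℝ :=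
  ⨆ j : {j : Fin n // j ∉ T}, U T j E

/-- Smallest utility of the coalition in the view of a participant outside of it. -/
def utilityMin (U : Finset (Fin n) → Fin n → Execution n → ℝ) (T : Finset (Fin n))
    (E : Execution n) : ℝ :=
  ⨅ j : {j : Fin n // j ∉ T}, U T j E

end Payoffs

/-- The number of rounds is a non-constant polynomial in the security parameter, and not zero. -/
def PolynomialRounds (r : ℕ → ℕ) : Prop :=
  ∃ P : Polynomial ℝ, 0 < P.natDegree ∧ ∀ κ : ℕ, 1 ≤ κ → (r κ : ℝ) = P.eval (κ : ℝ) ∧ r κ ≠ 0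

/-- The events `G κ` hold with overwhelming probability: the probability of the complement is
negligible in `κ`. -/
def Overwhelming {Ω : ℕ → Type} [∀ κ, MeasurableSpace (Ω κ)] (μ : ∀ κ, Measure (Ω κ))
    (G : ∀ κ, Set (Ω κ)) : Prop :=
  Asymptotics.SuperpolynomialDecay Filter.atTop (fun κ : ℕ => (κ : ℝ))
    fun κ => (μ κ).real (G κ)ᶜ

/-- The protocol is a `(t, ε, ε')`-equilibrium with virtual payoffs according to the utility `U`:
for every coalition `T` of at most `t` participants, every static adversary with fixed cost
controlling `T` and every admissible environment, in two independent executions, one in which `T`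
follows the protocol and one in which the adversary plays, with overwhelming probability the
adversary's largest utility is at most the smallest utility for following the protocol, up to the
factor `ε` and the summand `ε'`. -/
def IsEVP (Prot : Protocol) (U : Finset (Fin Prot.n) → Fin Prot.n → Execution Prot.n → ℝ)
    (t : ℕ) (ε ε' : ℝ) : Prop :=
  ∀ T : Finset (Fin Prot.n), T.card ≤ t →
  ∀ r : ℕ → ℕ, PolynomialRounds r →
  ∀ (D : ℕ → DeliveryOrder Prot.n) (Z : ℕ → Environment Prot.n) (A : ℕ → Adversary Prot.n Prot.q),
    Overwhelming
      (fun κ => (randomnessLaw Prot (Z κ) (followProtocol Prot κ) (r κ)).prod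
        (randomnessLaw Prot (Z κ) (A κ) (r κ)))
      (fun κ => {ω |
        let E := execution Prot κ T (D κ) (Z κ) (followProtocol Prot κ) ω.1
        let E' := execution Prot κ T (D κ) (Z κ) (A κ) ω.2
        utilityMax U T E' ≤ utilityMin U T E + ε * |utilityMin U T E| + ε'})

end Fruitchain

end

/-! Both utilities are governed by the number of fruits that the coalition finds, and this number is
concentrated around its mean.

Deviating. The adversary fixes its number of queries per round in advance. Its cost is therefore
deterministic (`sum_cost_execution`), and however adaptively it chooses the contents of its queries,
the answers are the oracle's values at a fixed set of `C` slots (`countP_log`). A valid chain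
contains only fruits that were really found, so the reward is at most `wf` times the number of
successes in these slots (`card_chainFruits_execution_le`), about `pf * C` by Hoeffding's
inequality.

Following. If the coalition follows the protocol, then everybody does and the execution is a
`SynchronousRun`: all local chains have the same length, and a round with exactly one block makes
everyone agree on it. If every window of `κ` rounds contains such a round, the block `κ` behind any
tip belongs to all later chains (`back_mem_chain`). A new fruit therefore stays recent until the
next successful round, where it is included in all chains (`query_mem_chainFruits`). Only fruits of
the last few rounds can be lost.

Comparison. Let `a = pf * wf` and `N = r * |T| * q`. Since `c ≤ a`, asking fewer queries does not
help: deviating yields at most `(a - c) N + (δ₁/2) a N`, following at least `(a - c) N - δ₁ a N`. By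
`c ≤ a (1 - δ₁) φ` the latter is at least `(1 - φ)(1 - δ₁) a N`, so the factor `4δ₁/(1 - φ)` covers
the gap (`add_mul_abs_of_bounds`). The exceptional events have probability exponentially small in
`κ` (up to a factor `r`) or in `r`, which grows at least linearly in `κ`. -/

noncomputable section

namespace Fruitchain

/-! ### Ancestors and heights in a chain. -/

namespace Node

variable {n : ℕ}

lemma mem_chain_self (B : Node n) : B ∈ B.chain := by
  cases B <;> simp [chain]

lemma genesis_mem_chain (B : Node n) : genesis ∈ B.chain := by
  induction B using Node.rec (motive_2 := fun _ => True) with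
  | genesis => simp [chain]
  | mined m i k b f P Q F rec hP _ _ => simp [chain, hP]
  | nil => trivial
  | cons _ _ _ _ => trivial

lemma mem_chain_mined {m : Fin n} {i k : ℕ} {b f : Bool} {P Q : Node n} {F : List (Node n)}
    {rec : List Bool} {A : Node n} :
    A ∈ (mined m i k b f P Q F rec).chain ↔ A = mined m i k b f P Q F rec ∨ A ∈ P.chain := by
  simp [chain]

/-- Induction along the chain ending in a node. -/
lemma chain_induction {motive : Node n → Prop} (genesis : motive .genesis)
    (mined : ∀ m i k b f P Q F rec, motive P → motive (.mined m i k b f P Q F rec))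
    (B : Node n) : motive B := by
  induction B using Node.rec (motive_2 := fun _ => True) with
  | genesis => exact genesis
  | mined m i k b f P Q F rec hP _ _ => exact mined m i k b f P Q F rec hP
  | nil => trivial
  | cons _ _ _ _ => trivial

lemma mem_chain_trans {A B C : Node n} (hA : A ∈ B.chain) (hB : B ∈ C.chain) : A ∈ C.chain := by
  induction C using chain_induction with
  | genesis =>
    simp only [chain, List.mem_singleton] at hB
    subst hB
    exact hA
  | mined m i k b f P Q F rec ih =>
    rcases mem_chain_mined.1 hB with rfl | hB
    · exact hA
    · exact mem_chain_mined.2 (.inr (ih hB))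

lemma height_le_of_mem_chain {A B : Node n} (h : A ∈ B.chain) : A.height ≤ B.height := by
  induction B using chain_induction with
  | genesis =>
    simp only [chain, List.mem_singleton] at h
    rw [h]
  | mined m i k b f P Q F rec ih =>
    rcases mem_chain_mined.1 h with rfl | h
    · exact le_rfl
    · exact (ih h).trans (Nat.le_succ _)

/-- Two blocks of the same chain are comparable. -/
lemma mem_chain_of_height_le {A B C : Node n} (hA : A ∈ C.chain) (hB : B ∈ C.chain)
    (h : A.height ≤ B.height) : A ∈ B.chain := by
  induction C using chain_induction with
  | genesis =>
    simp only [chain, List.mem_singleton] at hA hB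
    subst hA hB
    exact mem_chain_self _
  | mined m i k b f P Q F rec ih =>
    rcases mem_chain_mined.1 hB with rfl | hB
    · exact hA
    · rcases mem_chain_mined.1 hA with rfl | hA
      · have := height_le_of_mem_chain hB
        simp only [height] at h
        omega
      · exact ih hA hB

lemma parent_mem_chain (B : Node n) : B.parent ∈ B.chain := by
  cases B with
  | genesis => simp [parent, chain]
  | mined m i k b f P Q F rec => exact mem_chain_mined.2 (.inr (mem_chain_self _))

lemma back_mem_chain (d : ℕ) (B : Node n) : B.back d ∈ B.chain := by
  induction d generalizing B with
  | zero => exact mem_chain_self B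
  | succ d ih => exact mem_chain_trans (ih B.parent) (parent_mem_chain B)

/-- Truncated subtraction is right here, because the genesis block is its own parent. -/
lemma height_back (d : ℕ) (B : Node n) : (B.back d).height = B.height - d := by
  induction d generalizing B with
  | zero => rfl
  | succ d ih =>
    rw [back, ih]
    cases B with
    | genesis => simp [parent, height]
    | mined m i k b f P Q F rec => simp [parent, height]

lemma eq_genesis_of_height_eq_zero {B : Node n} (h : B.height = 0) : B = genesis := by
  cases B with
  | genesis => rfl
  | mined => simp [height] at h

lemma mem_chainFruits {f B : Node n} : f ∈ B.chainFruits ↔ ∃ X ∈ B.chain, f ∈ X.fruits := by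
  simp [chainFruits]

lemma chainFruits_subset {A B : Node n} (h : A ∈ B.chain) : A.chainFruits ⊆ B.chainFruits := by
  intro f hf
  obtain ⟨X, hX, hf⟩ := mem_chainFruits.1 hf
  exact mem_chainFruits.2 ⟨X, mem_chain_trans hX h, hf⟩

end Node

/-! ### Validity of chains and processing of messages. -/

variable {n : ℕ}

lemma validChain_genesis (window : ℕ) (log : List (Node n)) :
    ValidChain window log .genesis := by
  intro B hB h
  simp only [Node.chain, List.mem_singleton] at hB
  exact absurd hB h

lemma ValidChain.mono {window : ℕ} {log log' : List (Node n)} (h : log ⊆ log') {x : Node n}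
    (hx : ValidChain window log x) : ValidChain window log' x := by
  intro B hB hB'
  obtain ⟨h1, h2, h3⟩ := hx B hB hB'
  exact ⟨h h1, h2, fun f hf => ⟨h (h3 f hf).1, (h3 f hf).2⟩⟩

/-- The fruits of a valid chain are successful queries. -/
lemma ValidChain.mem_log_of_mem_chainFruits {window : ℕ} {log : List (Node n)} {x f : Node n}
    (hx : ValidChain window log x) (hf : f ∈ x.chainFruits) : f ∈ log ∧ f.isFruit = true := by
  obtain ⟨B, hB, hf⟩ := Node.mem_chainFruits.1 hf
  have hB' : B ≠ .genesis := by
    rintro rfl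
    simp [Node.fruits] at hf
  have := (hx B hB hB').2.2 f hf
  exact ⟨this.1, this.2.1⟩

namespace LocalView

/-- The right-hand side does not see the order of the messages, so the delivery order cannot affect
which fruits are stored. -/
lemma mem_known_foldl_receive {window : ℕ} {log l : List (Node n)} {v : LocalView n}
    {x : Node n} : x ∈ (l.foldl (receive window log) v).known ↔
      x ∈ v.known ∨ (x ∈ l ∧ x ∈ log ∧ x.isFruit = true) := by
  induction l generalizing v with
  | nil => simp
  | cons y l ih =>
    rw [List.foldl_cons, ih]
    have : x ∈ (v.receive window log y).known ↔
        x ∈ v.known ∨ (x = y ∧ x ∈ log ∧ x.isFruit = true) := by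
      unfold receive
      dsimp only
      split_ifs with h
      · rw [List.mem_append, List.mem_singleton]
        constructor
        · rintro (h' | rfl)
          · exact .inl h'
          · exact .inr ⟨rfl, h.1, h.2.1⟩
        · rintro (h' | h')
          · exact .inl h'
          · exact .inr h'.1
      · constructor
        · exact .inl
        · rintro (h' | ⟨rfl, h1, h2⟩)
          · exact h'
          · by_contra h3
            exact h ⟨h1, h2, h3⟩
    rw [this, List.mem_cons]
    tauto

/-- The local chain after processing messages is the old one or one of the messages. -/
lemma tip_foldl_receive (window : ℕ) (log l : List (Node n)) (v : LocalView n) :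
    (l.foldl (receive window log) v).tip = v.tip ∨
      ((l.foldl (receive window log) v).tip ∈ l ∧
        ValidChain window log (l.foldl (receive window log) v).tip) := by
  induction l generalizing v with
  | nil => exact .inl rfl
  | cons y l ih =>
    rw [List.foldl_cons]
    rcases ih (v.receive window log y) with h | h
    · rw [h]
      unfold receive
      dsimp only
      split_ifs with h'
      · exact .inr ⟨List.mem_cons_self, h'.1⟩
      · exact .inl rfl
    · exact .inr ⟨List.mem_cons_of_mem _ h.1, h.2⟩

lemma height_le_tip_foldl_receive (window : ℕ) (log l : List (Node n)) (v : LocalView n) :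
    v.tip.height ≤ (l.foldl (receive window log) v).tip.height := by
  induction l generalizing v with
  | nil => exact le_rfl
  | cons y l ih =>
    rw [List.foldl_cons]
    refine le_trans ?_ (ih _)
    unfold receive
    dsimp only
    split_ifs with h'
    · exact h'.2.le
    · exact le_rfl

/-- The local chain is at least as long as every valid chain received. -/
lemma height_le_tip_of_mem {window : ℕ} {log l : List (Node n)} {v : LocalView n} {x : Node n}
    (hx : x ∈ l) (hv : ValidChain window log x) :
    x.height ≤ (l.foldl (receive window log) v).tip.height := by
  induction l generalizing v with
  | nil => simp at hx
  | cons y l ih =>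
    rw [List.foldl_cons]
    rcases List.mem_cons.1 hx with rfl | hx
    · refine le_trans ?_ (height_le_tip_foldl_receive window log l _)
      unfold receive
      dsimp only
      split_ifs with h'
      · exact le_rfl
      · by_contra h
        exact h' ⟨hv, by omega⟩
    · exact ih hx

lemma validChain_tip_foldl_receive {window : ℕ} {log log' l : List (Node n)} {v : LocalView n}
    (hl : log' ⊆ log) (hv : ValidChain window log' v.tip) :
    ValidChain window log (l.foldl (receive window log) v).tip := by
  rcases tip_foldl_receive window log l v with h | h
  · rw [h]
    exact hv.mono hl
  · exact h.2

end LocalView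

/-! ### Synchronous runs: chain growth, common prefix and inclusion of fruits. -/

/-- The query that the protocol prescribes to participant `m` as its `k`-th one in round `i`, with
its answer, when the views and inputs at the beginning of the round are given. -/
def protocolQuery {q : ℕ} (depth window : ℕ) (ans : ℕ → Fin n → Fin q → Bool × Bool)
    (input : ℕ → Fin n → List Bool) (V : ℕ → Fin n → LocalView n) (i : ℕ) (m : Fin n)
    (k : Fin q) : Node n :=
  ((V i m).puzzle depth window (input i m)).solve m i k (ans i m k)

/-- A synchronous run of the protocol in which all participants follow it: `V i` are their views
and `log i` the queries made before round `i`, and `msg i m` the messages that `m` receives in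
round `i`, namely all successful queries of the round in some order. -/
structure SynchronousRun {q : ℕ} (depth window : ℕ) (ans : ℕ → Fin n → Fin q → Bool × Bool)
    (input : ℕ → Fin n → List Bool) (V : ℕ → Fin n → LocalView n) (log : ℕ → List (Node n))
    (msg : ℕ → Fin n → List (Node n)) : Prop where
  start : ∀ m, V 0 m = .start
  log_subset : ∀ i, log i ⊆ log (i + 1)
  query_mem_log : ∀ i m k, protocolQuery depth window ans input V i m k ∈ log (i + 1)
  step : ∀ i m, V (i + 1) m = (msg i m).foldl (LocalView.receive window (log (i + 1))) (V i m)
  mem_msg : ∀ i m x, x ∈ msg i m ↔ ∃ m' k, x = protocolQuery depth window ans input V i m' k ∧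
    (x.isBlock = true ∨ x.isFruit = true)

namespace SynchronousRun

variable {q depth window : ℕ} {ans : ℕ → Fin n → Fin q → Bool × Bool}
  {input : ℕ → Fin n → List Bool} {V : ℕ → Fin n → LocalView n} {log : ℕ → List (Node n)}
  {msg : ℕ → Fin n → List (Node n)}

local notation "query" => protocolQuery depth window ans input V

/-- Some block is found in round `i`. -/
def Successful (ans : ℕ → Fin n → Fin q → Bool × Bool) (i : ℕ) : Prop :=
  ∃ m k, (ans i m k).1 = true

/-- Exactly one block is found in round `i`. -/
def UniquelySuccessful (ans : ℕ → Fin n → Fin q → Bool × Bool) (i : ℕ) : Prop :=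
  ∃ m k, ∀ m' k', (ans i m' k').1 = true ↔ m' = m ∧ k' = k

lemma UniquelySuccessful.successful {i : ℕ} (h : UniquelySuccessful ans i) : Successful ans i := by
  obtain ⟨m, k, h⟩ := h
  exact ⟨m, k, (h m k).2 ⟨rfl, rfl⟩⟩

lemma height_query (i : ℕ) (m : Fin n) (k : Fin q) :
    (query i m k).height = (V i m).tip.height + 1 := rfl

lemma mem_chain_query {i : ℕ} {m : Fin n} {k : Fin q} {x : Node n} :
    x ∈ (query i m k).chain ↔ x = query i m k ∨ x ∈ (V i m).tip.chain :=
  Node.mem_chain_mined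

variable (h : SynchronousRun depth window ans input V log msg)

include h

lemma known_subset {i : ℕ} {m : Fin n} {x : Node n} (hx : x ∈ (V i m).known) :
    x ∈ log i ∧ x.isFruit = true := by
  induction i with
  | zero => simp [h.start, LocalView.start] at hx
  | succ i ih =>
    rw [h.step, LocalView.mem_known_foldl_receive] at hx
    rcases hx with hx | hx
    · exact ⟨h.log_subset i (ih hx).1, (ih hx).2⟩
    · exact hx.2

lemma mem_known_of_le {i j : ℕ} (hij : i ≤ j) {m : Fin n} {x : Node n}
    (hx : x ∈ (V i m).known) : x ∈ (V j m).known := by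
  induction j, hij using Nat.le_induction with
  | base => exact hx
  | succ j _ ih =>
    rw [h.step, LocalView.mem_known_foldl_receive]
    exact .inl ih

/-- A fruit is known to everyone at the end of the round in which it is found. -/
lemma query_mem_known {i : ℕ} {m : Fin n} {k : Fin q} (hk : (ans i m k).2 = true) (m' : Fin n) :
    query i m k ∈ (V (i + 1) m').known := by
  rw [h.step, LocalView.mem_known_foldl_receive]
  exact .inr ⟨(h.mem_msg i m' _).2 ⟨m, k, rfl, .inr hk⟩, h.query_mem_log i m k, hk⟩

lemma validChain_tip (i : ℕ) (m : Fin n) : ValidChain window (log i) (V i m).tip := by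
  induction i with
  | zero =>
    rw [h.start]
    exact validChain_genesis _ _
  | succ i ih =>
    rw [h.step]
    exact LocalView.validChain_tip_foldl_receive (h.log_subset i) ih

/-- The filter in `LocalView.puzzle` enforces what validity demands: stored fruits are logged
successes, and recency is tested against the very tip that is extended. -/
lemma validChain_query {i : ℕ} {m : Fin n} {k : Fin q} (hk : (ans i m k).1 = true) :
    ValidChain window (log (i + 1)) (query i m k) := by
  intro B hB hB'
  rcases mem_chain_query.1 hB with rfl | hB
  · refine ⟨h.query_mem_log i m k, hk, fun f hf => ?_⟩
    have hf' : f ∈ (V i m).known ∧ f.Recent window (V i m).tip ∧ f ∉ (V i m).tip.chainFruits := by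
      simpa [protocolQuery, Puzzle.solve, LocalView.puzzle, Node.fruits] using hf
    exact ⟨h.log_subset i (h.known_subset hf'.1).1, (h.known_subset hf'.1).2, hf'.2.1⟩
  · exact (h.validChain_tip i m).mono (h.log_subset i) B hB hB'

/-- The new local chain is the old one or ends in a block of this round. -/
lemma tip_succ (i : ℕ) (m : Fin n) : (V (i + 1) m).tip = (V i m).tip ∨
    ∃ m' k, (ans i m' k).1 = true ∧ (V (i + 1) m).tip = query i m' k := by
  have := LocalView.tip_foldl_receive window (log (i + 1)) (msg i m) (V i m)
  rw [← h.step] at this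
  refine this.imp_right fun ⟨h1, h2⟩ => ?_
  obtain ⟨m', k, h3, -⟩ := (h.mem_msg i m _).1 h1
  refine ⟨m', k, ?_, h3⟩
  rw [h3] at h2
  exact (h2 _ (Node.mem_chain_self _) (by simp [protocolQuery, Puzzle.solve])).2.1

open scoped Classical in
/-- All local chains have the same length, the number of successful rounds. -/
lemma height_tip (i : ℕ) (m : Fin n) : (V i m).tip.height = Nat.count (Successful ans) i := by
  induction i generalizing m with
  | zero => simp [h.start, LocalView.start, Node.height]
  | succ i ih =>
    rw [Nat.count_succ]
    split_ifs with hs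
    · obtain ⟨m', k, hk⟩ := hs
      -- Lower bound: `m` receives a valid block extending a chain of the common length. The upper
      -- bound comes from `tip_succ`.
      have h1 := LocalView.height_le_tip_of_mem (v := V i m)
        ((h.mem_msg i m _).2 ⟨m', k, rfl, .inl hk⟩) (h.validChain_query hk)
      rw [← h.step, height_query, ih] at h1
      rcases h.tip_succ i m with h2 | ⟨m'', k', -, h2⟩
      · rw [h2, ih] at h1
        omega
      · rw [h2, height_query, ih]
    · rcases h.tip_succ i m with h2 | ⟨m'', k', h3, h2⟩
      · rw [h2, ih, add_zero]
      · exact absurd ⟨m'', k', h3⟩ hs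

lemma tip_succ_of_successful {i : ℕ} (hi : Successful ans i) (m : Fin n) :
    ∃ m' k, (ans i m' k).1 = true ∧ (V (i + 1) m).tip = query i m' k := by
  classical
  refine (h.tip_succ i m).resolve_left fun h1 => ?_
  have := congrArg Node.height h1
  rw [h.height_tip, h.height_tip, Nat.count_succ, if_pos hi] at this
  omega

/-- What all participants have in their chains stays there. -/
lemma mem_chain_of_le {i j : ℕ} (hij : i ≤ j) {x : Node n} (hx : ∀ m, x ∈ (V i m).tip.chain)
    (m : Fin n) : x ∈ (V j m).tip.chain := by
  induction j, hij using Nat.le_induction generalizing m with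
  | base => exact hx m
  | succ j _ ih =>
    rcases h.tip_succ j m with h1 | ⟨m', k, -, h1⟩
    · rw [h1]
      exact ih m
    · rw [h1]
      exact mem_chain_query.2 (.inr (ih m'))

/-- In a round with only one block everyone adopts it. -/
lemma exists_common_block {i j : ℕ} (hi : UniquelySuccessful ans i) (hij : i < j) :
    ∃ x : Node n, (∀ m, x ∈ (V j m).tip.chain) ∧ ∀ m, x.height = (V i m).tip.height + 1 := by
  have hs := hi.successful
  obtain ⟨m, k, hk⟩ := hi
  refine ⟨query i m k, fun m' => ?_, fun m' => ?_⟩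
  · refine h.mem_chain_of_le (i := i + 1) hij (fun m'' => ?_) m'
    obtain ⟨m₁, k₁, h1, h2⟩ := h.tip_succ_of_successful hs m''
    obtain ⟨rfl, rfl⟩ := (hk m₁ k₁).1 h1
    rw [h2]
    exact Node.mem_chain_self _
  · classical
    rw [height_query, h.height_tip, h.height_tip]

/-- Common prefix: if every sufficiently long interval of rounds contains a uniquely successful
one, then the block `depth` positions behind the tip of a local chain stays in all local chains. -/
lemma back_mem_chain {r : ℕ}
    (hu : ∀ s, s + depth ≤ r → ∃ j, s ≤ j ∧ j < s + depth ∧ UniquelySuccessful ans j)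
    {i j : ℕ} (hij : i ≤ j) (hi : i ≤ r) (m m' : Fin n) :
    (V i m).tip.back depth ∈ (V j m').tip.chain := by
  classical
  have hh := Node.height_back depth (V i m).tip
  rw [h.height_tip] at hh
  by_cases hd : i ≤ depth
  · have : (V i m).tip.back depth = .genesis := Node.eq_genesis_of_height_eq_zero <| by
      have := Nat.count_le (p := Successful ans) (n := i)
      omega
    rw [this]
    exact Node.genesis_mem_chain _
  -- A uniquely successful round `l` among the last `depth` rounds puts a block `x` into all chains.
  -- At most `i - l ≤ depth` rounds from `l` on are successful, so the block `depth` behind the tip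
  -- is no higher than `x`, hence an ancestor of it.
  · obtain ⟨l, hl1, hl2, hl⟩ := hu (i - depth) (by omega)
    obtain ⟨x, hx1, hx2⟩ := h.exists_common_block hl (j := i) (by omega)
    refine h.mem_chain_of_le hij (fun m'' => ?_) m'
    refine Node.mem_chain_trans ?_ (hx1 m'')
    refine Node.mem_chain_of_height_le (Node.back_mem_chain _ _) (hx1 m) ?_
    rw [hx2 m, hh, h.height_tip]
    have h1 : Nat.count (Successful ans) i ≤ Nat.count (Successful ans) l + (i - l) := by
      conv_lhs => rw [show i = l + (i - l) by omega]
      rw [Nat.count_add]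
      exact Nat.add_le_add_left (Nat.count_le _) _
    omega

/-- A fruit is contained in all local chains after the next successful round. -/
lemma query_mem_chainFruits {r : ℕ} (hdepth : 2 ≤ depth) (hwindow : 2 * depth ≤ window)
    (hu : ∀ s, s + depth ≤ r → ∃ j, s ≤ j ∧ j < s + depth ∧ UniquelySuccessful ans j)
    {i : ℕ} {m : Fin n} {k : Fin q} (hk : (ans i m k).2 = true) {j : ℕ} (hij : i < j) (hjr : j < r)
    (hj : Successful ans j) (m' : Fin n) : query i m k ∈ (V r m').tip.chainFruits := by
  classical
  -- Invariant: either the fruit is already in all chains, or no round after `i` has been successful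
  -- yet and the chains have not grown since the end of round `i`.
  have key : ∀ t, i + 1 ≤ t → (∀ m', query i m k ∈ (V t m').tip.chainFruits) ∨
      ((∀ s, i < s → s < t → ¬ Successful ans s) ∧
        Nat.count (Successful ans) t = Nat.count (Successful ans) (i + 1)) := by
    intro t ht
    induction t, ht using Nat.le_induction with
    | base => exact .inr ⟨fun s h1 h2 => by omega, rfl⟩
    | succ t ht ih =>
      rcases ih with ih | ⟨ih1, ih2⟩
      · refine .inl fun m' => ?_
        rcases h.tip_succ t m' with h1 | ⟨m₁, k₁, -, h1⟩
        · rw [h1]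
          exact ih m'
        · rw [h1]
          exact Node.chainFruits_subset (mem_chain_query.2 (.inr (Node.mem_chain_self _))) (ih m₁)
      · by_cases hs : Successful ans t
        · refine .inl fun m' => ?_
          obtain ⟨m₁, k₁, -, h1⟩ := h.tip_succ_of_successful hs m'
          rw [h1]
          by_cases hf : query i m k ∈ (V t m₁).tip.chainFruits
          · exact Node.chainFruits_subset (mem_chain_query.2 (.inr (Node.mem_chain_self _))) hf
          refine Node.mem_chainFruits.2 ⟨_, Node.mem_chain_self _, ?_⟩
          have hrec : (query i m k).Recent window (V t m₁).tip := by
            refine ⟨h.back_mem_chain hu (by omega) (by omega) m m₁, ?_⟩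
            change (V t m₁).tip.height + 1 ≤ ((V i m).tip.back depth).height + window
            -- The tip has gained at most one block since round `i`, and the new block adds one
            -- more; the pointer lies at most `depth` below the old tip. So `depth + 2 ≤ window`
            -- suffices, which follows from `2 ≤ depth` and `2 * depth ≤ window`.
            rw [Node.height_back, h.height_tip, h.height_tip, ih2, Nat.count_succ]
            split_ifs <;> omega
          have : query i m k ∈ ((V t m₁).puzzle depth window (input t m₁)).fruits := by
            simp only [LocalView.puzzle, List.mem_filter, decide_eq_true_eq]
            exact ⟨h.mem_known_of_le ht (h.query_mem_known hk m₁), hrec, hf⟩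
          exact this
        · refine .inr ⟨fun s h1 h2 => ?_, ?_⟩
          · rcases Nat.lt_succ_iff_lt_or_eq.1 h2 with h2 | rfl
            · exact ih1 s h1 h2
            · exact hs
          · rw [Nat.count_succ, if_neg hs, ih2, add_zero]
  rcases key r (by omega) with h1 | h1
  · exact h1 m'
  · exact absurd hj (h1.1 j hij hjr)

end SynchronousRun

/-! ### Oracle slots, the cost, and the upper bound on the reward. -/

section Counting

variable (Prot : Protocol) (κ : ℕ) (T : Finset (Fin Prot.n)) (D : DeliveryOrder Prot.n)
  (Z : Environment Prot.n) (A : Adversary Prot.n Prot.q)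

/-- The slots of a round that are used by the honest participants. -/
def honestSlots : List (Fin Prot.n × Fin Prot.q) :=
  ((List.finRange Prot.n).filter fun j => j ∉ T).flatMap fun j =>
    (List.finRange Prot.q).map fun k => (j, k)

lemma mem_honestSlots {x : Fin Prot.n × Fin Prot.q} : x ∈ honestSlots Prot T ↔ x.1 ∉ T := by
  obtain ⟨m, k⟩ := x
  simp [honestSlots]

lemma mem_adversarySlots {x : Fin Prot.n × Fin Prot.q} :
    x ∈ adversarySlots Prot T A ↔ x.1 ∈ T ∧ (x.2 : ℕ) < A.queries x.1 := by
  obtain ⟨m, k⟩ := x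
  simp [adversarySlots]

lemma nodup_honestSlots : (honestSlots Prot T).Nodup := by
  refine List.nodup_flatMap.2 ⟨fun j _ => ?_, ?_⟩
  · exact (List.nodup_finRange _).map fun a b h => (Prod.mk.inj h).2
  · refine ((List.nodup_finRange _).filter _).imp fun {a b} hab => ?_
    intro x hx hx'
    simp only [List.mem_map] at hx hx'
    obtain ⟨_, _, rfl⟩ := hx
    obtain ⟨_, _, h⟩ := hx'
    exact hab (Prod.mk.inj h).1.symm

lemma nodup_adversarySlots : (adversarySlots Prot T A).Nodup := by
  refine List.nodup_flatMap.2 ⟨fun j _ => ?_, ?_⟩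
  · exact ((List.nodup_finRange _).filter _).map fun a b h => (Prod.mk.inj h).2
  · refine ((List.nodup_finRange _).filter _).imp fun {a b} hab => ?_
    intro x hx hx'
    simp only [List.mem_map] at hx hx'
    obtain ⟨_, _, rfl⟩ := hx
    obtain ⟨_, _, h⟩ := hx'
    exact hab (Prod.mk.inj h).1.symm

lemma honestQueries_eq (i : ℕ) (ans : Fin Prot.n → Fin Prot.q → Bool × Bool)
    (views : Fin Prot.n → LocalView Prot.n) (input : Fin Prot.n → List Bool) :
    honestQueries Prot κ T i ans views input = (honestSlots Prot T).map fun mk =>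
      ((views mk.1).puzzle κ (Prot.R * κ) (input mk.1)).solve mk.1 i mk.2 (ans mk.1 mk.2) := by
  simp [honestQueries, honestSlots, List.map_flatMap, List.map_map, Function.comp_def]

/-- Every query of the adversary uses its slot. -/
lemma forall₂_adversaryQueries (i : ℕ) (ans : Fin Prot.n → Fin Prot.q → Bool × Bool)
    (a : A.State) :
    List.Forall₂ (fun x mk => ∃ P : Puzzle Prot.n, x = P.solve mk.1 i mk.2 (ans mk.1 mk.2))
      (adversaryQueries Prot T A i ans a).2 (adversarySlots Prot T A) := by
  unfold adversaryQueries
  generalize adversarySlots Prot T A = l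
  suffices H : ∀ (l l₀ : List (Fin Prot.n × Fin Prot.q)) (a : A.State) (acc : List (Node Prot.n)),
      List.Forall₂ (fun x mk => ∃ P : Puzzle Prot.n, x = P.solve mk.1 i mk.2 (ans mk.1 mk.2))
        acc l₀ →
      List.Forall₂ (fun x mk => ∃ P : Puzzle Prot.n, x = P.solve mk.1 i mk.2 (ans mk.1 mk.2))
        (l.foldl (fun s mk =>
          let x := (A.ask s.1 mk.1).solve mk.1 i mk.2 (ans mk.1 mk.2)
          (A.answer s.1 x, s.2 ++ [x])) (a, acc)).2 (l₀ ++ l) from H l [] a [] .nil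
  intro l
  induction l with
  | nil =>
    intro l₀ a acc h
    simpa using h
  | cons mk l ih =>
    intro l₀ a acc h
    rw [List.foldl_cons, List.append_cons]
    exact ih _ _ _ (List.rel_append h (.cons ⟨_, rfl⟩ .nil))

lemma countP_eq_of_forall₂ {α β : Type*} {P : α → Bool} {P' : β → Bool} {l : List α} {l' : List β}
    (h : List.Forall₂ (fun x y => P x = P' y) l l') : l.countP P = l'.countP P' := by
  induction h with
  | nil => rfl
  | cons h _ ih => rw [List.countP_cons, List.countP_cons, ih, h]

open scoped Classical in
/-- The slots of a round in which a query is asked. -/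
def roundSlots : Finset (Fin Prot.n × Fin Prot.q) :=
  Finset.univ.filter fun x => x.1 ∈ T → (x.2 : ℕ) < A.queries x.1

lemma countP_slots (P : Fin Prot.n × Fin Prot.q → Bool) :
    (honestSlots Prot T).countP P + (adversarySlots Prot T A).countP P =
      ((roundSlots Prot T A).filter fun x => P x = true).card := by
  classical
  rw [← List.countP_append, List.countP_eq_length_filter, ← List.toFinset_card_of_nodup]
  · congr 1
    ext x
    simp only [List.mem_toFinset, List.mem_filter, List.mem_append, mem_honestSlots,
      mem_adversarySlots, roundSlots, Finset.mem_filter, Finset.mem_univ, true_and]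
    tauto
  · refine List.Nodup.filter _ (List.Nodup.append (nodup_honestSlots Prot T)
      (nodup_adversarySlots Prot T A) fun x hx hx' => ?_)
    exact (mem_honestSlots Prot T).1 hx ((mem_adversarySlots Prot T A).1 hx').1

/-- The oracle's answers in an execution of `r` rounds, continued by failures. -/
def answers {r : ℕ} (ω : Randomness Prot r) (i : ℕ) (m : Fin Prot.n) (k : Fin Prot.q) :
    Bool × Bool :=
  if h : i < r then ω.2.2 (⟨i, h⟩, m, k) else (false, false)

lemma worldAfter_succ {r : ℕ} (ω : Randomness Prot r) (i : ℕ) :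
    worldAfter Prot κ T D Z A ω (i + 1) =
      playRound Prot κ T D Z A i (answers Prot ω i) (worldAfter Prot κ T D Z A ω i) := rfl

section PlayRound

variable (i : ℕ) (ans : Fin Prot.n → Fin Prot.q → Bool × Bool) (W : World Z A)

/-- The successful queries of the honest participants in a round. -/
def sentMessages : List (Node Prot.n) :=
  (honestQueries Prot κ T i ans W.views (Z.input W.env)).filter
    fun x => x.isBlock = true ∨ x.isFruit = true

open scoped Classical in
/-- State of the adversary after its queries in a round, and the list of these queries. -/
def adversaryTurn : A.State × List (Node Prot.n) :=
  adversaryQueries Prot T A i ans (A.activate W.adv (Z.toAdversary W.env)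
    (fun j => if j ∈ T then Z.input W.env j else []) (sentMessages Prot κ T Z A i ans W))

open scoped Classical in
/-- The messages delivered to a participant in a round. -/
def deliveredMessages (j : Fin Prot.n) : List (Node Prot.n) :=
  A.deliver (adversaryTurn Prot κ T Z A i ans W).1 j ++
    D.order i j ((sentMessages Prot κ T Z A i ans W).filter
      fun x => x ∉ A.deliver (adversaryTurn Prot κ T Z A i ans W).1 j)

lemma playRound_log : (playRound Prot κ T D Z A i ans W).log =
    W.log ++ honestQueries Prot κ T i ans W.views (Z.input W.env) ++
      (adversaryTurn Prot κ T Z A i ans W).2 := by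
  unfold playRound adversaryTurn
  congr!

lemma playRound_views_of_mem {j : Fin Prot.n} (hj : j ∈ T) :
    (playRound Prot κ T D Z A i ans W).views j = W.views j := if_pos hj

lemma playRound_views_of_notMem {j : Fin Prot.n} (hj : j ∉ T) :
    (playRound Prot κ T D Z A i ans W).views j =
      (deliveredMessages Prot κ T D Z A i ans W j).foldl
        (LocalView.receive (Prot.R * κ) (playRound Prot κ T D Z A i ans W).log) (W.views j) :=
  if_neg hj

open scoped Classical in
lemma playRound_adv : (playRound Prot κ T D Z A i ans W).adv =
    A.finish (adversaryTurn Prot κ T Z A i ans W).1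
      (fun j => if j ∈ T then deliveredMessages Prot κ T D Z A i ans W j else [])
      (playRound Prot κ T D Z A i ans W).log := rfl

end PlayRound

/-- Counting queries by a property that only depends on the slot. -/
lemma countP_log {r : ℕ} (ω : Randomness Prot r) (P : Node Prot.n → Bool)
    (P' : ℕ → Fin Prot.n × Fin Prot.q → Bool)
    (hP : ∀ i mk (Q : Puzzle Prot.n),
      P (Q.solve mk.1 i mk.2 (answers Prot ω i mk.1 mk.2)) = P' i mk) (t : ℕ) :
    (worldAfter Prot κ T D Z A ω t).log.countP P =
      ∑ i ∈ Finset.range t, ((roundSlots Prot T A).filter fun x => P' i x = true).card := by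
  induction t with
  | zero => simp [worldAfter]
  | succ i ih =>
    rw [Finset.sum_range_succ, ← ih, ← countP_slots]
    rw [worldAfter_succ, playRound_log, List.countP_append, List.countP_append, honestQueries_eq,
      List.countP_map, add_assoc]
    refine congrArg₂ _ rfl (congrArg₂ _ ?_ ?_)
    · exact congrArg₂ _ (funext fun mk => hP i mk _) rfl
    · refine countP_eq_of_forall₂ ((forall₂_adversaryQueries Prot T A i _ _).imp ?_)
      rintro x mk ⟨Q, rfl⟩
      exact hP i mk Q

lemma log_subset_succ {r : ℕ} (ω : Randomness Prot r) (i : ℕ) :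
    (worldAfter Prot κ T D Z A ω i).log ⊆ (worldAfter Prot κ T D Z A ω (i + 1)).log := by
  intro x hx
  rw [worldAfter_succ, playRound_log]
  simp [hx]

/-- The local chains of the honest participants are valid. -/
lemma validChain_worldAfter {r : ℕ} (ω : Randomness Prot r) (i : ℕ) (j : Fin Prot.n) :
    ValidChain (Prot.R * κ) (worldAfter Prot κ T D Z A ω i).log
      ((worldAfter Prot κ T D Z A ω i).views j).tip := by
  induction i with
  | zero => exact validChain_genesis _ _
  | succ i ih =>
    have hl := log_subset_succ Prot κ T D Z A ω i
    by_cases hj : j ∈ T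
    · rw [worldAfter_succ, playRound_views_of_mem _ _ _ _ _ _ _ _ _ hj]
      exact ih.mono hl
    · rw [worldAfter_succ, playRound_views_of_notMem _ _ _ _ _ _ _ _ _ hj]
      exact LocalView.validChain_tip_foldl_receive hl ih

variable {Prot}

open scoped Classical in
/-- The number of fruits found in a set of slots. -/
def fruitCount {r : ℕ} (S : Finset (Fin r × Fin Prot.n × Fin Prot.q))
    (a : Fin r × Fin Prot.n × Fin Prot.q → Bool × Bool) : ℕ :=
  (S.filter fun s => (a s).2 = true).card

open scoped Classical in
/-- The slots used by the coalition in an execution of `r` rounds. -/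
def coalitionSlots (r : ℕ) : Finset (Fin r × Fin Prot.n × Fin Prot.q) :=
  Finset.univ.filter fun s => s.2.1 ∈ T ∧ (s.2.2 : ℕ) < A.queries s.2.1

lemma card_coalitionSlots_le (r : ℕ) : (coalitionSlots T A r).card ≤ r * (T.card * Prot.q) := by
  have : coalitionSlots T A r ⊆ Finset.univ ×ˢ (T ×ˢ Finset.univ) := by
    intro s hs
    simp only [coalitionSlots, Finset.mem_filter] at hs
    simp [hs.2.1]
  refine (Finset.card_le_card this).trans ?_
  simp [Finset.card_product]

/-- Sums over the rounds of numbers of slots. -/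
lemma sum_card_roundSlots {r : ℕ} (P : ℕ → Fin Prot.n × Fin Prot.q → Prop)
    [∀ i, DecidablePred (P i)] :
    ∑ i ∈ Finset.range r, ((roundSlots Prot T A).filter (P i)).card =
      (Finset.univ.filter fun s : Fin r × Fin Prot.n × Fin Prot.q =>
        (s.2.1 ∈ T → (s.2.2 : ℕ) < A.queries s.2.1) ∧ P s.1 s.2).card := by
  classical
  rw [Finset.sum_range, Finset.card_filter, Fintype.sum_prod_type]
  refine Finset.sum_congr rfl fun i _ => ?_
  rw [roundSlots, Finset.filter_filter, Finset.card_filter]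

lemma minedBy_solve {Q : Puzzle Prot.n} {m l : Fin Prot.n} {i k : ℕ} {a : Bool × Bool} :
    (Q.solve m i k a).MinedBy l ↔ m = l := Iff.rfl

/-- The right-hand side does not involve `ω`: the adversary's commitment makes its cost
deterministic. -/
lemma sum_cost_execution {r : ℕ} (ω : Randomness Prot r) (c : ℝ) :
    ∑ l ∈ T, cost c l (execution Prot κ T D Z A ω) = c * ((coalitionSlots T A r).card : ℝ) := by
  classical
  unfold cost
  rw [← Finset.mul_sum, ← Nat.cast_sum]
  congr 2
  rw [Finset.card_eq_sum_card_fiberwise (f := fun s => s.2.1) (t := T)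
    (fun s hs => by
      simp only [coalitionSlots, Finset.coe_filter, Set.mem_ofPred_eq] at hs
      exact hs.2.1)]
  refine Finset.sum_congr rfl fun l hl => ?_
  rw [← List.countP_eq_length_filter]
  unfold execution
  dsimp only
  rw [countP_log Prot κ T D Z A ω _ (fun _ mk => decide (mk.1 = l)) (fun i mk Q => by
    simp [minedBy_solve]) r, sum_card_roundSlots]
  congr 1
  ext s
  simp only [coalitionSlots, Finset.mem_filter, Finset.mem_univ, true_and, decide_eq_true_eq]
  constructor
  · rintro ⟨h1, rfl⟩
    exact ⟨⟨hl, h1 hl⟩, rfl⟩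
  · rintro ⟨h1, rfl⟩
    exact ⟨fun _ => h1.2, rfl⟩

open scoped Classical in
/-- The coalition cannot have more fruits in a chain than it has found. -/
lemma card_chainFruits_execution_le {r : ℕ} (ω : Randomness Prot r) (j : Fin Prot.n) :
    (((execution Prot κ T D Z A ω).views j).tip.chainFruits.toFinset.filter
      fun f => ∃ l ∈ T, f.MinedBy l).card ≤ fruitCount (coalitionSlots T A r) ω.2.2 := by
  have hv := validChain_worldAfter Prot κ T D Z A ω r j
  calc _ ≤ ((worldAfter Prot κ T D Z A ω r).log.filter
        fun f => decide ((∃ l ∈ T, f.MinedBy l) ∧ f.isFruit = true)).toFinset.card := by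
        -- Fruits cannot be forged: one contained in a valid chain is a successful query in the log.
        refine Finset.card_le_card fun f hf => ?_
        simp only [Finset.mem_filter, List.mem_toFinset] at hf
        have := hv.mem_log_of_mem_chainFruits hf.1
        simp only [List.mem_toFinset, List.mem_filter, decide_eq_true_eq]
        exact ⟨this.1, hf.2, this.2⟩
    _ ≤ _ := List.toFinset_card_le _
    _ = _ := by
        rw [← List.countP_eq_length_filter, countP_log Prot κ T D Z A ω _
          (fun i mk => decide (mk.1 ∈ T ∧ (answers Prot ω i mk.1 mk.2).2 = true)) (fun i mk Q => by
            simp only [minedBy_solve, exists_eq_right', decide_eq_decide]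
            rfl) r, sum_card_roundSlots, fruitCount, coalitionSlots, Finset.filter_filter]
        congr 1
        ext s
        simp only [Finset.mem_filter, Finset.mem_univ, true_and, decide_eq_true_eq, answers,
          s.1.2, dif_pos, Fin.eta, Prod.mk.eta]
        tauto

end Counting

/-! ### The coalition following the protocol gives a synchronous run. -/

section FollowProtocol

variable (Prot : Protocol) (κ : ℕ) (T : Finset (Fin Prot.n)) (D : DeliveryOrder Prot.n)
  (Z : Environment Prot.n)

-- The members' views change only at the end of a round, so their queries do not depend on earlier
-- answers of the round and the adaptive fold collapses to a map. The hypothesis `ha` is met because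
-- `activate` empties `solved`.
open scoped Classical in
lemma adversaryQueries_followProtocol (i : ℕ) (ans : Fin Prot.n → Fin Prot.q → Bool × Bool)
    (a : CoalitionState Prot.n) (ha : a.solved = []) :
    adversaryQueries Prot T (followProtocol Prot κ) i ans a =
      let l := (adversarySlots Prot T (followProtocol Prot κ)).map fun mk =>
        ((a.views mk.1).puzzle κ (Prot.R * κ) (a.input mk.1)).solve mk.1 i mk.2 (ans mk.1 mk.2)
      (⟨a.views, a.input, l.filter fun x => x.isBlock = true ∨ x.isFruit = true⟩, l) := by
  unfold adversaryQueries
  generalize adversarySlots Prot T (followProtocol Prot κ) = l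
  suffices H : ∀ (l : List (Fin Prot.n × Fin Prot.q)) (acc acc' : List (Node Prot.n)),
      l.foldl (fun s mk =>
          let x := ((followProtocol Prot κ).ask s.1 mk.1).solve mk.1 i mk.2 (ans mk.1 mk.2)
          ((followProtocol Prot κ).answer s.1 x, s.2 ++ [x]))
          ((⟨a.views, a.input, acc⟩ : CoalitionState Prot.n), acc') =
        let l' := l.map fun mk =>
          ((a.views mk.1).puzzle κ (Prot.R * κ) (a.input mk.1)).solve mk.1 i mk.2 (ans mk.1 mk.2)
        ((⟨a.views, a.input, acc ++ l'.filter fun x => x.isBlock = true ∨ x.isFruit = true⟩ :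
          CoalitionState Prot.n), acc' ++ l') by
    obtain ⟨views, input, solved⟩ := a
    subst ha
    exact H l [] []
  intro l
  induction l with
  | nil =>
    intro acc acc'
    simp only [List.foldl_nil, List.map_nil, List.filter_nil, List.append_nil]
    rfl
  | cons mk l ih =>
    intro acc acc'
    rw [List.foldl_cons]
    dsimp only [followProtocol] at ih ⊢
    split_ifs with hs
    · rw [ih]
      simp only [List.map_cons, List.append_assoc, List.cons_append, List.nil_append]
      rw [List.filter_cons_of_pos (by simpa using hs)]
    · rw [ih]
      simp only [List.map_cons, List.append_assoc, List.cons_append, List.nil_append]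
      rw [List.filter_cons_of_neg (by simpa using hs)]

open scoped Classical in
/-- The views of all participants when the coalition follows the protocol. -/
def allViews (W : World Z (followProtocol Prot κ)) (m : Fin Prot.n) : LocalView Prot.n :=
  if m ∈ T then CoalitionState.views W.adv m else W.views m

lemma allViews_of_mem {W : World Z (followProtocol Prot κ)} {m : Fin Prot.n} (hm : m ∈ T) :
    allViews Prot κ T Z W m = CoalitionState.views W.adv m := if_pos hm

lemma allViews_of_notMem {W : World Z (followProtocol Prot κ)} {m : Fin Prot.n} (hm : m ∉ T) :
    allViews Prot κ T Z W m = W.views m := if_neg hm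

section PlayRound

variable (i : ℕ) (ans : Fin Prot.n → Fin Prot.q → Bool × Bool)
  (W : World Z (followProtocol Prot κ))

/-- The query in a given slot of a round when the coalition follows the protocol. -/
def slotQuery (mk : Fin Prot.n × Fin Prot.q) : Node Prot.n :=
  ((allViews Prot κ T Z W mk.1).puzzle κ (Prot.R * κ) (Z.input W.env mk.1)).solve
    mk.1 i mk.2 (ans mk.1 mk.2)

lemma honestQueries_followProtocol :
    honestQueries Prot κ T i ans W.views (Z.input W.env) =
      (honestSlots Prot T).map (slotQuery Prot κ T Z i ans W) := by
  rw [honestQueries_eq]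
  refine List.map_congr_left fun mk hmk => ?_
  rw [slotQuery, allViews_of_notMem _ _ _ _ ((mem_honestSlots Prot T).1 hmk)]

open scoped Classical in
lemma adversaryTurn_followProtocol :
    adversaryTurn Prot κ T Z (followProtocol Prot κ) i ans W =
      let l := (adversarySlots Prot T (followProtocol Prot κ)).map (slotQuery Prot κ T Z i ans W)
      (⟨CoalitionState.views W.adv, fun j => if j ∈ T then Z.input W.env j else [],
        l.filter fun x => x.isBlock = true ∨ x.isFruit = true⟩, l) := by
  have hl : (adversarySlots Prot T (followProtocol Prot κ)).map (slotQuery Prot κ T Z i ans W) =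
      (adversarySlots Prot T (followProtocol Prot κ)).map fun mk =>
        ((CoalitionState.views W.adv mk.1).puzzle κ (Prot.R * κ)
          (if mk.1 ∈ T then Z.input W.env mk.1 else [])).solve mk.1 i mk.2 (ans mk.1 mk.2) := by
    refine List.map_congr_left fun mk hmk => ?_
    have hm := ((mem_adversarySlots Prot T _).1 hmk).1
    rw [slotQuery, allViews_of_mem _ _ _ _ hm, if_pos hm]
  rw [adversaryTurn]
  refine (adversaryQueries_followProtocol Prot κ T i ans _ rfl).trans ?_
  rw [hl]
  rfl

lemma mem_slots {mk : Fin Prot.n × Fin Prot.q} :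
    mk ∈ honestSlots Prot T ∨ mk ∈ adversarySlots Prot T (followProtocol Prot κ) := by
  rw [mem_honestSlots, mem_adversarySlots]
  by_cases h : mk.1 ∈ T
  · exact .inr ⟨h, mk.2.2⟩
  · exact .inl h

lemma slotQuery_mem_log (mk : Fin Prot.n × Fin Prot.q) : slotQuery Prot κ T Z i ans W mk ∈
    (playRound Prot κ T D Z (followProtocol Prot κ) i ans W).log := by
  rw [playRound_log, honestQueries_followProtocol, adversaryTurn_followProtocol]
  dsimp only
  rw [List.mem_append, List.mem_append]
  rcases mem_slots Prot κ T (mk := mk) with h | h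
  · exact .inl (.inr (List.mem_map_of_mem h))
  · exact .inr (List.mem_map_of_mem h)

/-- The successful queries of a round are delivered to everyone, and nothing else. -/
lemma mem_deliveredMessages (j : Fin Prot.n) (x : Node Prot.n) :
    x ∈ deliveredMessages Prot κ T D Z (followProtocol Prot κ) i ans W j ↔
      ∃ m k, x = slotQuery Prot κ T Z i ans W (m, k) ∧ (x.isBlock = true ∨ x.isFruit = true) := by
  classical
  have h1 : x ∈ (followProtocol Prot κ).deliver
        (adversaryTurn Prot κ T Z (followProtocol Prot κ) i ans W).1 j ↔
      (∃ mk ∈ adversarySlots Prot T (followProtocol Prot κ),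
        slotQuery Prot κ T Z i ans W mk = x) ∧ (x.isBlock = true ∨ x.isFruit = true) := by
    rw [adversaryTurn_followProtocol]
    dsimp only [followProtocol]
    rw [List.mem_filter, List.mem_map, decide_eq_true_eq]
  have h2 : x ∈ sentMessages Prot κ T Z (followProtocol Prot κ) i ans W ↔
      (∃ mk ∈ honestSlots Prot T,
        slotQuery Prot κ T Z i ans W mk = x) ∧ (x.isBlock = true ∨ x.isFruit = true) := by
    rw [sentMessages, honestQueries_followProtocol, List.mem_filter, List.mem_map,
      decide_eq_true_eq]
  rw [deliveredMessages, List.mem_append, (D.perm i j _).mem_iff, List.mem_filter,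
    decide_eq_true_eq]
  constructor
  · rintro (h | ⟨h, -⟩)
    · obtain ⟨⟨mk, -, h⟩, hx⟩ := h1.1 h
      exact ⟨mk.1, mk.2, h.symm, hx⟩
    · obtain ⟨⟨mk, -, h⟩, hx⟩ := h2.1 h
      exact ⟨mk.1, mk.2, h.symm, hx⟩
  · rintro ⟨m, k, h, hx⟩
    by_cases hx' : x ∈ (followProtocol Prot κ).deliver
        (adversaryTurn Prot κ T Z (followProtocol Prot κ) i ans W).1 j
    · exact .inl hx'
    · refine .inr ⟨h2.2 ⟨⟨(m, k), ?_, h.symm⟩, hx⟩, hx'⟩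
      -- A success of the coalition would have been delivered first, so what remains comes from an
      -- honest participant.
      exact (mem_slots Prot κ T).resolve_right fun h' => hx' (h1.2 ⟨⟨_, h', h.symm⟩, hx⟩)

/-- Members' views are kept in the adversary's state and updated by `finish`, those of the others in
the world; both undergo the same fold, so the distinction disappears. -/
lemma allViews_playRound (m : Fin Prot.n) :
    allViews Prot κ T Z (playRound Prot κ T D Z (followProtocol Prot κ) i ans W) m =
      (deliveredMessages Prot κ T D Z (followProtocol Prot κ) i ans W m).foldl
        (LocalView.receive (Prot.R * κ)
          (playRound Prot κ T D Z (followProtocol Prot κ) i ans W).log)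
        (allViews Prot κ T Z W m) := by
  by_cases hm : m ∈ T
  · rw [allViews_of_mem _ _ _ _ hm, allViews_of_mem _ _ _ _ hm, playRound_adv]
    dsimp only [followProtocol]
    rw [if_pos hm]
    congr 1
    exact congrArg (fun s : CoalitionState Prot.n × List (Node Prot.n) => s.1.views m)
      (adversaryTurn_followProtocol Prot κ T Z i ans W)
  · rw [allViews_of_notMem _ _ _ _ hm, allViews_of_notMem _ _ _ _ hm,
      playRound_views_of_notMem _ _ _ _ _ _ _ _ _ hm]

end PlayRound

/-- When the coalition follows the protocol, the execution is a synchronous run. -/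
lemma synchronousRun_followProtocol {r : ℕ} (ω : Randomness Prot r) :
    SynchronousRun κ (Prot.R * κ) (answers Prot ω)
      (fun i => Z.input (worldAfter Prot κ T D Z (followProtocol Prot κ) ω i).env)
      (fun i => allViews Prot κ T Z (worldAfter Prot κ T D Z (followProtocol Prot κ) ω i))
      (fun i => (worldAfter Prot κ T D Z (followProtocol Prot κ) ω i).log)
      (fun i => deliveredMessages Prot κ T D Z (followProtocol Prot κ) i (answers Prot ω i)
        (worldAfter Prot κ T D Z (followProtocol Prot κ) ω i)) where
  start _ := ite_self _
  log_subset i := log_subset_succ Prot κ T D Z _ ω i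
  query_mem_log i m k := slotQuery_mem_log Prot κ T D Z i _ _ (m, k)
  step i m := allViews_playRound Prot κ T D Z i _ _ m
  mem_msg i m x := mem_deliveredMessages Prot κ T D Z i _ _ m x

variable {Prot}

open scoped Classical in
/-- The slots of the coalition in the first `t` rounds. -/
def earlySlots (r t : ℕ) : Finset (Fin r × Fin Prot.n × Fin Prot.q) :=
  Finset.univ.filter fun s => (s.1 : ℕ) < t ∧ s.2.1 ∈ T

lemma card_earlySlots {r t : ℕ} (ht : t ≤ r) :
    (earlySlots (Prot := Prot) T r t).card = t * (T.card * Prot.q) := by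
  classical
  have : earlySlots (Prot := Prot) T r t =
      (Finset.univ.filter fun i : Fin r => (i : ℕ) < t) ×ˢ (T ×ˢ Finset.univ) := by
    ext s
    simp [earlySlots]
  rw [this, Finset.card_product, Finset.card_product, Finset.card_univ, Fintype.card_fin]
  congr 1
  rw [Fin.card_filter_val_lt, min_eq_right ht]

open scoped Classical in
/-- If the coalition follows the protocol, its fruits are contained in all chains soon. -/
lemma fruitCount_earlySlots_le {r : ℕ} (hR : 2 ≤ Prot.R) (hκ : 2 ≤ κ) (ω : Randomness Prot r)
    (hu : ∀ s, s + κ ≤ r → ∃ j, s ≤ j ∧ j < s + κ ∧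
      SynchronousRun.UniquelySuccessful (answers Prot ω) j)
    {t : ℕ} (ht : ∃ j, t ≤ j ∧ j < r ∧ SynchronousRun.UniquelySuccessful (answers Prot ω) j)
    {j : Fin Prot.n} (hj : j ∉ T) :
    fruitCount (earlySlots T r t) ω.2.2 ≤
      (((execution Prot κ T D Z (followProtocol Prot κ) ω).views j).tip.chainFruits.toFinset.filter
        fun f => ∃ l ∈ T, f.MinedBy l).card := by
  have hrun := synchronousRun_followProtocol Prot κ T D Z ω
  obtain ⟨t', htt', ht'r, ht'⟩ := ht
  refine Finset.card_le_card_of_injOn (fun s => slotQuery Prot κ T Z s.1 (answers Prot ω s.1)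
    (worldAfter Prot κ T D Z (followProtocol Prot κ) ω s.1) s.2) (fun s hs => ?_) ?_
  · simp only [earlySlots, Finset.coe_filter, Finset.mem_filter, Finset.mem_univ, true_and,
      Set.mem_ofPred_eq] at hs
    simp only [Finset.coe_filter, List.mem_toFinset, Set.mem_ofPred_eq]
    refine ⟨?_, s.2.1, hs.1.2, rfl⟩
    have hk : (answers Prot ω s.1 s.2.1 s.2.2).2 = true := by
      simpa [answers] using hs.2
    have := hrun.query_mem_chainFruits hκ (Nat.mul_le_mul_right κ hR) hu hk
      (lt_of_lt_of_le hs.1.1 htt') ht'r ht'.successful j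
    rw [allViews_of_notMem _ _ _ _ hj] at this
    exact this
  -- The stamp of a node records round, miner and slot, so fruits from different slots are distinct.
  · rintro ⟨i, m, k⟩ - ⟨i', m', k'⟩ - h
    simp only [slotQuery, Puzzle.solve, Node.mined.injEq] at h
    simp only [Prod.mk.injEq, Fin.ext_iff]
    exact ⟨h.2.1, congrArg Fin.val h.1, h.2.2.1⟩

end FollowProtocol

/-! ### Concentration of the number of fruits. -/

/-- Hoeffding's inequality for the coordinates of a product space. -/
lemma measureReal_pi_sum_ge_le {ι α : Type*} [Fintype ι] [MeasurableSpace α] (ν : Measure α)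
    [IsProbabilityMeasure ν] {Y : α → ℝ} (hY : Measurable Y) (hY' : ∀ x, Y x ∈ Set.Icc (0 : ℝ) 1)
    (S : Finset ι) {t : ℝ} (ht : 0 < t) :
    (Measure.pi fun _ : ι => ν).real {a | t ≤ ∑ s ∈ S, (Y (a s) - ν[Y])} ≤
      Real.exp (-2 * t ^ 2 / Fintype.card ι) := by
  -- For empty `S` the exponent would involve a division by zero; there the event itself is empty
  -- since `0 < t`.
  rcases S.eq_empty_or_nonempty with rfl | hS
  · have : {a : ι → α | t ≤ ∑ s ∈ (∅ : Finset ι), (Y (a s) - ν[Y])} = ∅ := by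
      ext a
      simpa using ht
    rw [this, measureReal_empty]
    positivity
  have hsub : ∀ s ∈ S, HasSubgaussianMGF (fun a : ι → α => Y (a s) - ν[Y])
      ((‖(1 : ℝ) - 0‖₊ / 2) ^ 2) (Measure.pi fun _ : ι => ν) := by
    intro s _
    have h1 := hasSubgaussianMGF_of_mem_Icc (μ := ν) hY.aemeasurable
      (Filter.Eventually.of_forall hY')
    have h2 := measurePreserving_eval (fun _ : ι => ν) s
    rw [← h2.map_eq] at h1
    have h3 := HasSubgaussianMGF.of_map (Y := Function.eval s) h2.measurable.aemeasurable h1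
    rw [h2.map_eq] at h3
    exact h3
  have hind : iIndepFun (fun s (a : ι → α) => Y (a s) - ν[Y]) (Measure.pi fun _ : ι => ν) :=
    iIndepFun_pi (X := fun _ x => Y x - ν[Y]) fun _ => (hY.sub_const _).aemeasurable
  refine (HasSubgaussianMGF.measure_sum_ge_le_of_iIndepFun hind hsub ht.le).trans ?_
  rw [Real.exp_le_exp]
  have h1 : (0 : ℝ) < S.card := by exact_mod_cast hS.card_pos
  have h2 : (S.card : ℝ) ≤ Fintype.card ι := by exact_mod_cast Finset.card_le_univ S
  -- Each summand has range of length 1, hence variance proxy `1/4`.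
  have h3 : (2 * (∑ _s ∈ S, ((‖(1 : ℝ) - 0‖₊ / 2) ^ 2 : NNReal) : NNReal) : ℝ) = S.card / 2 := by
    simp
    ring
  rw [h3, neg_mul, neg_div, neg_div, neg_le_neg_iff,
    show t ^ 2 / ((S.card : ℝ) / 2) = 2 * t ^ 2 / S.card by field_simp]
  gcongr

variable (Prot : Protocol)

instance : IsProbabilityMeasure (answerLaw Prot) := by
  unfold answerLaw
  infer_instance

instance (Z : Environment Prot.n) (A : Adversary Prot.n Prot.q) (r : ℕ) :
    IsProbabilityMeasure (randomnessLaw Prot Z A r) := by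
  unfold randomnessLaw
  infer_instance

lemma answerLaw_real_fst_true : (answerLaw Prot).real {x | x.1 = true} = Prot.p := by
  have : {x : Bool × Bool | x.1 = true} = {true} ×ˢ Set.univ := by
    ext x
    simp
  rw [this, answerLaw, measureReal_prod_prod]
  simp

lemma answerLaw_real_fst_false : (answerLaw Prot).real {x | x.1 = false} = 1 - Prot.p := by
  have : {x : Bool × Bool | x.1 = false} = {false} ×ˢ Set.univ := by
    ext x
    simp
  rw [this, answerLaw, measureReal_prod_prod]
  simp

lemma answerLaw_real_snd_true : (answerLaw Prot).real {x | x.2 = true} = Prot.pf := by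
  have : {x : Bool × Bool | x.2 = true} = Set.univ ×ˢ {true} := by
    ext x
    simp
  rw [this, answerLaw, measureReal_prod_prod]
  simp

/-- Law of the oracle's answers in `r` rounds. -/
abbrev oracleLaw (r : ℕ) : Measure (Fin r × Fin Prot.n × Fin Prot.q → Bool × Bool) :=
  Measure.pi fun _ => answerLaw Prot

/-- The indicator of a fruit. -/
def fruitIndicator (x : Bool × Bool) : ℝ := if x.2 = true then 1 else 0

lemma integral_fruitIndicator : ∫ x, fruitIndicator x ∂(answerLaw Prot) = Prot.pf := by
  have : fruitIndicator = Set.indicator {x | x.2 = true} 1 := by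
    ext x
    simp [fruitIndicator, Set.indicator]
  rw [this, integral_indicator_one (Set.toFinite _).measurableSet, answerLaw_real_snd_true]

lemma measurable_fruitIndicator : Measurable fruitIndicator := measurable_of_finite _

lemma fruitCount_eq_sum {r : ℕ} (S : Finset (Fin r × Fin Prot.n × Fin Prot.q))
    (a : Fin r × Fin Prot.n × Fin Prot.q → Bool × Bool) :
    (fruitCount S a : ℝ) = ∑ s ∈ S, fruitIndicator (a s) := by
  classical
  simp [fruitCount, fruitIndicator, Finset.sum_boole]

/-- A set of slots is unlikely to yield many more fruits than expected. -/
lemma measureReal_fruitCount_ge_le {r : ℕ} (S : Finset (Fin r × Fin Prot.n × Fin Prot.q))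
    {t : ℝ} (ht : 0 < t) :
    (oracleLaw Prot r).real {a | (Prot.pf : ℝ) * S.card + t ≤ fruitCount S a} ≤
      Real.exp (-2 * t ^ 2 / (r * (Prot.n * Prot.q))) := by
  have := measureReal_pi_sum_ge_le (answerLaw Prot) measurable_fruitIndicator
    (fun x => by unfold fruitIndicator; split_ifs <;> simp) S ht
  simp only [Fintype.card_prod, Fintype.card_fin, Nat.cast_mul, integral_fruitIndicator,
    Finset.sum_sub_distrib, Finset.sum_const, nsmul_eq_mul, ← fruitCount_eq_sum] at this
  refine le_of_eq_of_le ?_ this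
  congr 1
  ext a
  simp only [Set.mem_ofPred_eq]
  constructor <;> intro h <;> linarith

/-- A set of slots is unlikely to yield much fewer fruits than expected. -/
lemma measureReal_fruitCount_le_le {r : ℕ} (S : Finset (Fin r × Fin Prot.n × Fin Prot.q))
    {t : ℝ} (ht : 0 < t) :
    (oracleLaw Prot r).real {a | (fruitCount S a : ℝ) ≤ Prot.pf * S.card - t} ≤
      Real.exp (-2 * t ^ 2 / (r * (Prot.n * Prot.q))) := by
  -- The lower tail is the upper tail for the number of failures.
  have := measureReal_pi_sum_ge_le (answerLaw Prot) (Y := fun x => 1 - fruitIndicator x)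
    (measurable_fruitIndicator.const_sub _)
    (fun x => by unfold fruitIndicator; split_ifs <;> simp) S ht
  have hint : Integrable fruitIndicator (answerLaw Prot) := .of_finite
  simp only [Fintype.card_prod, Fintype.card_fin, Nat.cast_mul,
    integral_sub (integrable_const _) hint, integral_fruitIndicator, integral_const,
    probReal_univ, smul_eq_mul, mul_one, sub_sub_sub_cancel_left,
    Finset.sum_sub_distrib, Finset.sum_const, nsmul_eq_mul, ← fruitCount_eq_sum] at this
  refine le_of_eq_of_le ?_ this
  congr 1
  ext a
  simp only [Set.mem_ofPred_eq]
  constructor <;> intro h <;> linarith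

/-! ### Rounds with exactly one block. -/

/-- In a round with answers `b`, the given slot yields the only block. -/
def OnlyBlockAt (x : Fin Prot.n × Fin Prot.q) : Set (Fin Prot.n × Fin Prot.q → Bool × Bool) :=
  {b | ∀ y, (b y).1 = true ↔ y = x}

/-- Probability that the given slot yields the only block of a round. -/
def onlyBlockProb (x : Fin Prot.n × Fin Prot.q) : ℝ :=
  (Measure.pi fun _ : Fin Prot.n × Fin Prot.q => answerLaw Prot).real (OnlyBlockAt Prot x)

/-- With the slot fixed, the event is a box with one factor `p` and all others `1 - p`. Any positive
constant independent of `κ` is enough later. -/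
lemma onlyBlockProb_pos (hp : 0 < (Prot.p : ℝ)) (hp' : (Prot.p : ℝ) < 1)
    (x : Fin Prot.n × Fin Prot.q) : 0 < onlyBlockProb Prot x := by
  classical
  have : OnlyBlockAt Prot x = Set.pi Set.univ fun y : Fin Prot.n × Fin Prot.q =>
      if y = x then {z : Bool × Bool | z.1 = true} else {z | z.1 = false} := by
    ext b
    simp only [OnlyBlockAt, Set.mem_ofPred_eq, Set.mem_pi, Set.mem_univ, true_imp_iff]
    refine forall_congr' fun y => ?_
    split_ifs with h <;> simp [h]
  rw [onlyBlockProb, this, measureReal_def, Measure.pi_pi, ENNReal.toReal_prod]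
  refine Finset.prod_pos fun y _ => ?_
  split_ifs
  · exact hp.trans_eq (answerLaw_real_fst_true Prot).symm
  · exact (sub_pos.2 hp').trans_eq (answerLaw_real_fst_false Prot).symm

lemma onlyBlockProb_le_one (x : Fin Prot.n × Fin Prot.q) : onlyBlockProb Prot x ≤ 1 :=
  measureReal_le_one

/-- The rounds are independent. -/
lemma measureReal_forall_not_onlyBlockAt {r : ℕ} (x : Fin Prot.n × Fin Prot.q)
    (J : Finset (Fin r)) :
    (oracleLaw Prot r).real {a | ∀ j ∈ J, (fun y => a (j, y)) ∉ OnlyBlockAt Prot x} =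
      (1 - onlyBlockProb Prot x) ^ J.card := by
  -- Currying groups the answers by rounds; the event becomes a box whose sides are the same for all
  -- rounds in `J`.
  have hpre : {a : Fin r × Fin Prot.n × Fin Prot.q → Bool × Bool |
        ∀ j ∈ J, (fun y => a (j, y)) ∉ OnlyBlockAt Prot x} =
      MeasurableEquiv.curry (Fin r) (Fin Prot.n × Fin Prot.q) (Bool × Bool) ⁻¹'
        Set.pi J fun _ => (OnlyBlockAt Prot x)ᶜ := rfl
  have hm : MeasurableSet (OnlyBlockAt Prot x)ᶜ := (Set.toFinite _).measurableSet
  rw [hpre, measureReal_def, oracleLaw, ← Measure.infinitePi_eq_pi,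
    ← MeasurableEquiv.map_apply, Measure.infinitePi_map_curry (fun _ _ => answerLaw Prot),
    Measure.infinitePi_pi _ (fun _ _ => hm), Finset.prod_const, ENNReal.toReal_pow,
    Measure.infinitePi_eq_pi, ← measureReal_def, probReal_compl_eq_one_sub hm.of_compl]
  rfl

/-- An interval of rounds is unlikely to contain no round with just one block. -/
lemma measureReal_interval_not_onlyBlockAt {r : ℕ} (x : Fin Prot.n × Fin Prot.q) {s l : ℕ}
    (hs : s + l ≤ r) :
    (oracleLaw Prot r).real {a | ∀ j : Fin r, s ≤ j → (j : ℕ) < s + l →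
      (fun y => a (j, y)) ∉ OnlyBlockAt Prot x} ≤ Real.exp (-onlyBlockProb Prot x * l) := by
  classical
  have h := measureReal_forall_not_onlyBlockAt Prot x
    (Finset.univ.filter fun j : Fin r => s ≤ j ∧ (j : ℕ) < s + l)
  have hcard : (Finset.univ.filter fun j : Fin r => s ≤ j ∧ (j : ℕ) < s + l).card = l := by
    rw [← Finset.card_map Fin.valEmbedding]
    have : (Finset.univ.filter fun j : Fin r => s ≤ j ∧ (j : ℕ) < s + l).map Fin.valEmbedding =
        Finset.Ico s (s + l) := by
      ext i
      simp only [Finset.mem_map, Finset.mem_filter, Finset.mem_univ, true_and,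
        Fin.valEmbedding_apply, Finset.mem_Ico]
      constructor
      · rintro ⟨j, hj, rfl⟩
        exact hj
      · exact fun hi => ⟨⟨i, by omega⟩, hi, rfl⟩
    rw [this, Nat.card_Ico]
    omega
  rw [hcard] at h
  simp only [Finset.mem_filter, Finset.mem_univ, true_and, and_imp] at h
  rw [h, mul_comm, Real.exp_nat_mul]
  refine pow_le_pow_left₀ (sub_nonneg.2 (onlyBlockProb_le_one Prot x)) ?_ _
  have := Real.add_one_le_exp (-onlyBlockProb Prot x)
  linarith

/-- It is unlikely that some long interval of rounds contains no round with just one block. -/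
lemma measureReal_exists_interval_not_onlyBlockAt {r : ℕ} (x : Fin Prot.n × Fin Prot.q) {l : ℕ}
    (hl : 0 < l) :
    (oracleLaw Prot r).real {a | ∃ s, s + l ≤ r ∧ ∀ j : Fin r, s ≤ j → (j : ℕ) < s + l →
      (fun y => a (j, y)) ∉ OnlyBlockAt Prot x} ≤
        r * Real.exp (-onlyBlockProb Prot x * l) := by
  classical
  have hsub : {a : Fin r × Fin Prot.n × Fin Prot.q → Bool × Bool |
      ∃ s, s + l ≤ r ∧ ∀ j : Fin r, s ≤ j → (j : ℕ) < s + l →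
        (fun y => a (j, y)) ∉ OnlyBlockAt Prot x} ⊆
      ⋃ s ∈ (Finset.range r).filter fun s => s + l ≤ r, {a | ∀ j : Fin r, s ≤ j →
        (j : ℕ) < s + l → (fun y => a (j, y)) ∉ OnlyBlockAt Prot x} := by
    rintro a ⟨s, hs, ha⟩
    simp only [Set.mem_iUnion]
    -- As `0 < l`, an interval that fits starts before round `r`, so at most `r` intervals occur.
    exact ⟨s, by simp only [Finset.mem_filter, Finset.mem_range]; omega, ha⟩
  refine (measureReal_mono hsub (measure_ne_top _ _)).trans
    ((measureReal_biUnion_finset_le _ _).trans ?_)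
  refine (Finset.sum_le_card_nsmul _ _ (Real.exp (-onlyBlockProb Prot x * l)) fun s hs =>
    measureReal_interval_not_onlyBlockAt Prot x (Finset.mem_filter.1 hs).2).trans ?_
  rw [nsmul_eq_mul]
  gcongr
  exact (Finset.card_filter_le _ _).trans_eq (Finset.card_range r)

/-! ### Negligible functions. -/

section Decay

open Filter Asymptotics

lemma superpolynomialDecay_exp_neg {b : ℝ} (hb : 0 < b) :
    SuperpolynomialDecay atTop (fun κ : ℕ => (κ : ℝ)) fun κ => Real.exp (-b * κ) := by
  intro d
  have h := (Real.tendsto_pow_mul_exp_neg_atTop_nhds_zero d).comp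
    ((tendsto_natCast_atTop_atTop (R := ℝ)).const_mul_atTop hb)
  have h' := h.const_mul ((b ^ d)⁻¹)
  rw [mul_zero] at h'
  refine h'.congr fun κ => ?_
  simp only [Function.comp_apply]
  rw [mul_pow, neg_mul]
  field_simp

/-- A number of rounds that is a non-constant polynomial grows at least linearly. -/
lemma PolynomialRounds.exists_linear_le {r : ℕ → ℕ} (hr : PolynomialRounds r) :
    ∃ a : ℝ, 0 < a ∧ ∀ᶠ κ : ℕ in atTop, a * κ ≤ r κ := by
  obtain ⟨P, hP, hr⟩ := hr
  have hlead : P.leadingCoeff ≠ 0 := by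
    rw [Polynomial.leadingCoeff_ne_zero]
    rintro rfl
    simp at hP
  obtain ⟨K, hK, h⟩ := (P.isEquivalent_atTop_lead.symm.isBigO).exists_pos
  refine ⟨|P.leadingCoeff| / K, by positivity, ?_⟩
  filter_upwards [(tendsto_natCast_atTop_atTop (R := ℝ)).eventually h.bound,
    eventually_ge_atTop 1] with κ h1 h2
  have hκ : (1 : ℝ) ≤ κ := by exact_mod_cast h2
  rw [div_mul_eq_mul_div, div_le_iff₀ hK]
  rw [← (hr κ h2).1, norm_mul, norm_pow, Real.norm_eq_abs, Real.norm_natCast,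
    Real.norm_natCast] at h1
  calc |P.leadingCoeff| * κ ≤ |P.leadingCoeff| * (κ : ℝ) ^ P.natDegree := by
        gcongr
        exact le_self_pow₀ hκ hP.ne'
    _ ≤ _ := h1
    _ = _ := mul_comm _ _

/-- Non-constancy of the polynomial enters here: bounds exponential in the number of rounds are
negligible in `κ` because `r` grows at least linearly. -/
lemma PolynomialRounds.superpolynomialDecay_exp_neg {r : ℕ → ℕ} (hr : PolynomialRounds r) {b : ℝ}
    (hb : 0 < b) :
    SuperpolynomialDecay atTop (fun κ : ℕ => (κ : ℝ)) fun κ => Real.exp (-b * r κ) := by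
  obtain ⟨a, ha, h⟩ := hr.exists_linear_le
  refine (Fruitchain.superpolynomialDecay_exp_neg (mul_pos hb ha)).trans_eventually_abs_le ?_
  filter_upwards [h] with κ hκ
  rw [Function.comp_apply, Function.comp_apply, Real.abs_exp, Real.abs_exp, Real.exp_le_exp]
  nlinarith

lemma PolynomialRounds.superpolynomialDecay_mul {r : ℕ → ℕ} (hr : PolynomialRounds r)
    {f : ℕ → ℝ} (hf : SuperpolynomialDecay atTop (fun κ : ℕ => (κ : ℝ)) f) :
    SuperpolynomialDecay atTop (fun κ : ℕ => (κ : ℝ)) fun κ => r κ * f κ := by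
  obtain ⟨P, -, hr⟩ := hr
  refine (hf.polynomial_mul P).congr' ?_
  filter_upwards [eventually_ge_atTop 1] with κ hκ
  simp [(hr κ hκ).1]

end Decay

/-! ### Deterministic comparison of the utilities. -/

section Utility

variable {n : ℕ} {U : Finset (Fin n) → Fin n → Execution n → ℝ} {T : Finset (Fin n)}
  {E : Execution n} {b : ℝ}

lemma utilityMax_le (hT : ∃ j, j ∉ T) (h : ∀ j ∉ T, U T j E ≤ b) : utilityMax U T E ≤ b := by
  obtain ⟨j, hj⟩ := hT
  have : Nonempty {j : Fin n // j ∉ T} := ⟨⟨j, hj⟩⟩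
  exact ciSup_le fun j => h j j.2

lemma le_utilityMin (hT : ∃ j, j ∉ T) (h : ∀ j ∉ T, b ≤ U T j E) : b ≤ utilityMin U T E := by
  obtain ⟨j, hj⟩ := hT
  have : Nonempty {j : Fin n // j ∉ T} := ⟨⟨j, hj⟩⟩
  exact le_ciInf fun j => h j j.2

end Utility

variable {Prot : Protocol} {κ : ℕ} {T : Finset (Fin Prot.n)} {D : DeliveryOrder Prot.n}
  {Z : Environment Prot.n} {A : Adversary Prot.n Prot.q} {wf c : ℝ} {r : ℕ}

lemma utilityMax_execution_le (hT : ∃ j, j ∉ T) (hwf : 0 ≤ wf) (ω : Randomness Prot r) :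
    utilityMax (rewardMinusCost wf c) T (execution Prot κ T D Z A ω) ≤
      wf * fruitCount (coalitionSlots T A r) ω.2.2 - c * (coalitionSlots T A r).card := by
  refine utilityMax_le hT fun j _ => ?_
  rw [rewardMinusCost, sum_cost_execution, reward]
  gcongr
  exact card_chainFruits_execution_le κ T D Z A ω j

lemma le_utilityMin_execution (hT : ∃ j, j ∉ T) (hc : 0 ≤ c)
    {ω : Randomness Prot r} {F : ℕ}
    (hF : ∀ j ∉ T, wf * F ≤ reward wf T j (execution Prot κ T D Z A ω)) :
    wf * F - c * (r * (T.card * Prot.q)) ≤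
      utilityMin (rewardMinusCost wf c) T (execution Prot κ T D Z A ω) := by
  refine le_utilityMin hT fun j hj => ?_
  rw [rewardMinusCost, sum_cost_execution]
  have : ((coalitionSlots T A r).card : ℝ) ≤ r * (T.card * Prot.q) := by
    exact_mod_cast card_coalitionSlots_le T A r
  have h := hF j hj
  gcongr

/-- The fruits that the coalition surely gets into all chains by following the protocol make up for
what it can gain by deviating. -/
lemma add_mul_abs_of_bounds {a c φ δ N C s x y : ℝ} (hφ : φ < 1) (hδ : 0 < δ)
    (hδ' : δ < 1 / 4) (ha : 0 < a) (hca : c ≤ a) (hcδ : c ≤ a * (1 - δ) * φ) (hN : 0 ≤ N)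
    (hCN : C ≤ N) (hs : s ≤ δ / 2 * a * N) (hy : y ≤ a * C + s - c * C)
    (hx : a * ((1 - δ / 2) * N) - s - c * N ≤ x) :
    y ≤ x + 4 * δ / (1 - φ) * |x| + 0 := by
  have haN : 0 ≤ a * N := by positivity
  have hφ' : 0 < 1 - φ := sub_pos.2 hφ
  have hx1 : (a * (1 - δ) - c) * N ≤ x := by nlinarith
  -- The bound `c ≤ a (1 - δ) φ` keeps a fixed share of the reward as profit, so a relative error
  -- can absorb deviations of order `a N`.
  have hx2 : (1 - φ) * ((1 - δ) * (a * N)) ≤ x := by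
    refine le_trans ?_ hx1
    nlinarith [mul_le_mul_of_nonneg_right hcδ hN]
  have hx3 : 3 * δ * (a * N) ≤ 4 * δ / (1 - φ) * |x| := by
    have h1 : (1 - φ) * ((1 - δ) * (a * N)) ≤ |x| := hx2.trans (le_abs_self x)
    -- Here `δ < 1/4` gives `3 ≤ 4 (1 - δ)`.
    calc 3 * δ * (a * N) ≤ 4 * δ * ((1 - δ) * (a * N)) := by nlinarith [mul_nonneg hδ.le haN]
      _ = 4 * δ / (1 - φ) * ((1 - φ) * ((1 - δ) * (a * N))) := by field_simp
      _ ≤ _ := by gcongr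
  have hy1 : y ≤ (a - c) * N + δ / 2 * (a * N) := by
    nlinarith [mul_le_mul_of_nonneg_left hCN (sub_nonneg.2 hca)]
  -- By `hx1` and `hy1`, `y - x` is at most `(3/2) δ a N`, half of what `hx3` provides.
  nlinarith [mul_nonneg hδ.le haN]

lemma uniquelySuccessful_of_onlyBlockAt {x : Fin Prot.n × Fin Prot.q} {ω : Randomness Prot r}
    {j : Fin r} (h : (fun y => ω.2.2 (j, y)) ∈ OnlyBlockAt Prot x) :
    SynchronousRun.UniquelySuccessful (answers Prot ω) j := by
  refine ⟨x.1, x.2, fun m k => ?_⟩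
  have := h (m, k)
  simpa [answers, Prod.ext_iff] using this

/-! ### Probability that deviating pays off. -/

section Bound

variable (Prot κ T D Z A)

/-- The executions for which the utility of the adversary is too large. -/
def badRandomness (wf c ε : ℝ) (r : ℕ) : Set (Randomness Prot r × Randomness Prot r) :=
  {ω |
    let E := execution Prot κ T D Z (followProtocol Prot κ) ω.1
    let E' := execution Prot κ T D Z A ω.2
    utilityMax (rewardMinusCost wf c) T E' ≤ utilityMin (rewardMinusCost wf c) T E +
      ε * |utilityMin (rewardMinusCost wf c) T E| + 0}ᶜ

/-- A coalition without queries has no fruits and no cost. This case is separate because otherwise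
`1 ≤ |T| * q` is needed to absorb the Hoeffding slack. -/
lemma badRandomness_eq_empty (hT : ∃ j, j ∉ T) (hwf : 0 ≤ wf) (hc : 0 ≤ c)
    (h0 : T.card * Prot.q = 0) {ε : ℝ} (hε : 0 ≤ ε) :
    badRandomness Prot κ T D Z A wf c ε r = ∅ := by
  rw [badRandomness, Set.compl_empty_iff, Set.eq_univ_iff_forall]
  intro ω
  have h1 : (coalitionSlots T A r).card = 0 := by
    have := card_coalitionSlots_le T A r
    simpa [h0] using this
  have h2 : fruitCount (coalitionSlots T A r) ω.2.2.2 = 0 :=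
    Nat.le_zero.1 ((Finset.card_filter_le _ _).trans_eq h1)
  have h3 := utilityMax_execution_le (κ := κ) (D := D) (Z := Z) (A := A) (c := c) hT hwf ω.2
  have h4 := le_utilityMin_execution (κ := κ) (D := D) (Z := Z) (A := followProtocol Prot κ) hT
    hc (ω := ω.1) (F := 0) fun j _ => by
      rw [Nat.cast_zero, mul_zero]
      unfold reward
      positivity
  have h5 : (T.card * Prot.q : ℝ) = 0 := by exact_mod_cast h0
  rw [h1, h2] at h3
  rw [h5] at h4
  simp only [Nat.cast_zero, mul_zero, sub_zero] at h3 h4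
  rw [Set.mem_ofPred_eq]
  dsimp only
  have := mul_nonneg hε (abs_nonneg (utilityMin (rewardMinusCost wf c) T
    (execution Prot κ T D Z (followProtocol Prot κ) ω.1)))
  linarith

/-- Unless the oracle's answers are very unlikely, deviating does not pay off. -/
lemma badRandomness_subset {φ δ : ℝ} (hT : ∃ j, j ∉ T) (hR : 2 ≤ Prot.R) (hκ : 2 ≤ κ)
    (hφ : φ < 1) (hδ : 0 < δ) (hδ' : δ < 1 / 4) (hwf : 0 < wf) (hpf : 0 < (Prot.pf : ℝ))
    (hc : 0 ≤ c) (hca : c ≤ Prot.pf * wf) (hcδ : c ≤ Prot.pf * wf * (1 - δ) * φ)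
    (h0 : 0 < T.card * Prot.q) (x : Fin Prot.n × Fin Prot.q) {L : ℕ} (hL : (L : ℝ) ≤ δ / 2 * r)
    (hLr : L ≤ r) :
    badRandomness Prot κ T D Z A wf c (4 * δ / (1 - φ)) r ⊆
      (fun ω => ω.1.2.2) ⁻¹' {a | ∃ s, s + κ ≤ r ∧ ∀ j : Fin r, s ≤ j → (j : ℕ) < s + κ →
        (fun y => a (j, y)) ∉ OnlyBlockAt Prot x} ∪
      (fun ω => ω.1.2.2) ⁻¹' {a | ∀ j : Fin r, r - L ≤ j → (j : ℕ) < r - L + L →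
        (fun y => a (j, y)) ∉ OnlyBlockAt Prot x} ∪
      (fun ω => ω.1.2.2) ⁻¹' {a | (fruitCount (earlySlots T r (r - L)) a : ℝ) ≤
        Prot.pf * (earlySlots (Prot := Prot) T r (r - L)).card - δ / 2 * Prot.pf * r} ∪
      (fun ω => ω.2.2.2) ⁻¹' {a | (Prot.pf : ℝ) * (coalitionSlots T A r).card + δ / 2 * Prot.pf * r ≤
        (fruitCount (coalitionSlots T A r) a : ℝ)} := by
  intro ω hω
  by_contra hgood
  simp only [Set.mem_union, Set.mem_preimage, Set.mem_ofPred_eq, not_or, not_exists, not_and,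
    not_forall, not_le, not_not] at hgood
  obtain ⟨⟨⟨h1, h2⟩, h3⟩, h4⟩ := hgood
  refine hω ?_
  rw [Set.mem_ofPred_eq]
  dsimp only
  have hFE : ∀ j ∉ T, wf * fruitCount (earlySlots T r (r - L)) ω.1.2.2 ≤
      reward wf T j (execution Prot κ T D Z (followProtocol Prot κ) ω.1) := by
    intro j hj
    unfold reward
    gcongr
    refine fruitCount_earlySlots_le κ T D Z hR hκ ω.1 (fun s hs => ?_) ?_ hj
    · obtain ⟨i, hi1, hi2, hi3⟩ := h1 s hs
      exact ⟨i, hi1, hi2, uniquelySuccessful_of_onlyBlockAt hi3⟩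
    · obtain ⟨i, hi1, hi2, hi3⟩ := h2
      exact ⟨i, hi1, i.2, uniquelySuccessful_of_onlyBlockAt hi3⟩
  have hmin := le_utilityMin_execution hT hc hFE
  have hmax := utilityMax_execution_le (κ := κ) (D := D) (Z := Z) (A := A) (c := c) hT hwf.le ω.2
  have hM : (1 : ℝ) ≤ T.card * Prot.q := by exact_mod_cast h0
  have hr : (0 : ℝ) ≤ r := Nat.cast_nonneg r
  rw [card_earlySlots T (Nat.sub_le r L)] at h3
  push_cast [Nat.cast_sub hLr] at h3
  have hC : ((coalitionSlots T A r).card : ℝ) ≤ r * (T.card * Prot.q) := by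
    exact_mod_cast card_coalitionSlots_le T A r
  -- The slack `s` is `wf` times the deviation allowed in the fruit counts; it is at most `δ / 2 * a
  -- * N` by `hM`.
  refine add_mul_abs_of_bounds (a := Prot.pf * wf) (c := c) (N := r * (T.card * Prot.q))
    (C := (coalitionSlots T A r).card) (s := wf * (δ / 2 * Prot.pf * r)) hφ hδ hδ'
    (mul_pos hpf hwf) hca hcδ (by positivity) hC ?_ ?_ ?_
  · calc wf * (δ / 2 * Prot.pf * r) = δ / 2 * (Prot.pf * wf) * (r * 1) := by ring
      _ ≤ _ := by gcongr
  · refine hmax.trans ?_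
    have := mul_le_mul_of_nonneg_left h4.le hwf.le
    linarith
  · refine le_trans ?_ hmin
    have h5 := mul_le_mul_of_nonneg_left h3.le hwf.le
    -- Ignoring the fruits of the last `L ≤ δ / 2 * r` rounds costs at most the fraction `δ / 2` of
    -- the expected reward.
    have h6 : (Prot.pf * wf) * ((1 - δ / 2) * (r * (T.card * Prot.q))) ≤
        (Prot.pf * wf) * ((r - L) * (T.card * Prot.q)) := by
      have : (1 - δ / 2) * (r * (T.card * Prot.q)) ≤ (r - L) * ((T.card : ℝ) * Prot.q) := by
        rw [← mul_assoc]
        gcongr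
        linarith
      gcongr
    linarith

/-- The exceptional events concern only the oracle's answers of one execution, whose law is a
marginal; the coins of the machines play no role. -/
lemma measureReal_fst_preimage (A₁ A₂ : Adversary Prot.n Prot.q)
    (B : Set (Fin r × Fin Prot.n × Fin Prot.q → Bool × Bool)) :
    ((randomnessLaw Prot Z A₁ r).prod (randomnessLaw Prot Z A₂ r)).real
      ((fun ω => ω.1.2.2) ⁻¹' B) = (oracleLaw Prot r).real B := by
  have h : MeasurePreserving (fun ω : Randomness Prot r × Randomness Prot r => ω.1.2.2)
      ((randomnessLaw Prot Z A₁ r).prod (randomnessLaw Prot Z A₂ r)) (oracleLaw Prot r) :=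
    (measurePreserving_snd.comp measurePreserving_snd).comp measurePreserving_fst
  exact h.measureReal_preimage (Set.toFinite B).measurableSet.nullMeasurableSet

lemma measureReal_snd_preimage (A₁ A₂ : Adversary Prot.n Prot.q)
    (B : Set (Fin r × Fin Prot.n × Fin Prot.q → Bool × Bool)) :
    ((randomnessLaw Prot Z A₁ r).prod (randomnessLaw Prot Z A₂ r)).real
      ((fun ω => ω.2.2.2) ⁻¹' B) = (oracleLaw Prot r).real B := by
  have h : MeasurePreserving (fun ω : Randomness Prot r × Randomness Prot r => ω.2.2.2)
      ((randomnessLaw Prot Z A₁ r).prod (randomnessLaw Prot Z A₂ r)) (oracleLaw Prot r) :=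
    (measurePreserving_snd.comp measurePreserving_snd).comp measurePreserving_snd
  exact h.measureReal_preimage (Set.toFinite B).measurableSet.nullMeasurableSet

/-- A union bound over the four events of `badRandomness_subset`. The bound is uniform in adversary,
environment and delivery order; the factor 2 counts the two Hoeffding tails. -/
lemma measureReal_badRandomness_le {φ δ : ℝ} (hT : ∃ j, j ∉ T) (hR : 2 ≤ Prot.R) (hκ : 2 ≤ κ)
    (hφ : φ < 1) (hδ : 0 < δ) (hδ' : δ < 1 / 4) (hwf : 0 < wf) (hpf : 0 < (Prot.pf : ℝ))
    (hc : 0 ≤ c) (hca : c ≤ Prot.pf * wf) (hcδ : c ≤ Prot.pf * wf * (1 - δ) * φ)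
    (h0 : 0 < T.card * Prot.q) (x : Fin Prot.n × Fin Prot.q) (hr : 0 < r) :
    ((randomnessLaw Prot Z (followProtocol Prot κ) r).prod (randomnessLaw Prot Z A r)).real
      (badRandomness Prot κ T D Z A wf c (4 * δ / (1 - φ)) r) ≤
        r * Real.exp (-onlyBlockProb Prot x * κ) +
        Real.exp (onlyBlockProb Prot x) * Real.exp (-(onlyBlockProb Prot x * (δ / 2)) * r) +
        2 * Real.exp (-((δ * Prot.pf) ^ 2 / (2 * (Prot.n * Prot.q))) * r) := by
  have hr' : (0 : ℝ) < r := by exact_mod_cast hr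
  obtain ⟨L, hL⟩ : ∃ L, L = ⌊δ / 2 * r⌋₊ := ⟨_, rfl⟩
  have hL1 : (L : ℝ) ≤ δ / 2 * r := hL ▸ Nat.floor_le (by positivity)
  have hL2 : δ / 2 * r < L + 1 := hL ▸ Nat.lt_floor_add_one _
  have hLr : L ≤ r := by
    have : (L : ℝ) ≤ r := by nlinarith
    exact_mod_cast this
  have ht : 0 < δ / 2 * Prot.pf * r := by positivity
  have hexp : -2 * (δ / 2 * Prot.pf * r) ^ 2 / (r * (Prot.n * Prot.q)) =
      -((δ * Prot.pf) ^ 2 / (2 * (Prot.n * Prot.q))) * r := by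
    field_simp
  refine (measureReal_mono (badRandomness_subset Prot κ T D Z A hT hR hκ hφ hδ hδ' hwf hpf hc hca
    hcδ h0 x hL1 hLr) (measure_ne_top _ _)).trans ?_
  refine (measureReal_union_le _ _).trans ?_
  rw [two_mul, ← add_assoc]
  refine add_le_add ((measureReal_union_le _ _).trans (add_le_add
    ((measureReal_union_le _ _).trans (add_le_add ?_ ?_)) ?_)) ?_
  · rw [measureReal_fst_preimage]
    exact measureReal_exists_interval_not_onlyBlockAt Prot x (by omega)
  · rw [measureReal_fst_preimage, ← Real.exp_add]
    refine (measureReal_interval_not_onlyBlockAt Prot x (by omega)).trans (Real.exp_le_exp.2 ?_)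
    -- Rounding down gives only `L > δ / 2 * r - 1`, which is the origin of the factor `exp
    -- (onlyBlockProb Prot x)`.
    have : 0 ≤ onlyBlockProb Prot x := measureReal_nonneg
    nlinarith
  · rw [measureReal_fst_preimage, ← hexp]
    exact measureReal_fruitCount_le_le Prot _ ht
  · rw [measureReal_snd_preimage, ← hexp]
    exact measureReal_fruitCount_ge_le Prot _ ht

end Bound

end Fruitchain

end

theorem mainTheorem8 (Prot : Fruitchain.Protocol) (hn : 0 < Prot.n) (hR : 2 ≤ Prot.R)
    (hp : 0 < (Prot.p : ℝ)) (hpf : (Prot.p : ℝ) < Prot.pf)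
    (wf c φ : ℝ) (hc : 0 ≤ c) (hφ : φ ∈ Set.Ioo (0 : ℝ) 1) (hcφ : c < Prot.pf * wf * φ)
    (δ₁ : ℝ) (hδ₁ : δ₁ ∈ Set.Ioo (0 : ℝ) 0.25) (hcδ : c ≤ Prot.pf * wf * (1 - δ₁) * φ)
    (hδφ : 4 * δ₁ < 1 - φ) :
    Fruitchain.IsEVP Prot (Fruitchain.rewardMinusCost wf c) (Prot.n - 1) (4 * δ₁ / (1 - φ)) 0 := by
  open Fruitchain in
  intro T hTcard r hr D Z A
  have hpf' : 0 < (Prot.pf : ℝ) := hp.trans hpf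
  -- Positivity of `wf` is not assumed; it follows from `0 ≤ c < pf * wf * φ`.
  have hawf : 0 < Prot.pf * wf := pos_of_mul_pos_left (hc.trans_lt hcφ) hφ.1.le
  have hwf : 0 < wf := pos_of_mul_pos_right hawf hpf'.le
  have hca : c ≤ Prot.pf * wf := hcφ.le.trans (mul_le_of_le_one_right hawf.le hφ.2.le)
  have hδ : δ₁ < 1 / 4 := by
    have := hδ₁.2
    norm_num at this ⊢
    exact this
  have hT : ∃ j, j ∉ T := by
    by_contra! h
    have : T = Finset.univ := Finset.eq_univ_iff_forall.2 h
    rw [this, Finset.card_univ, Fintype.card_fin] at hTcard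
    omega
  change Asymptotics.SuperpolynomialDecay Filter.atTop (fun κ : ℕ => (κ : ℝ)) fun κ =>
    ((randomnessLaw Prot (Z κ) (followProtocol Prot κ) (r κ)).prod
      (randomnessLaw Prot (Z κ) (A κ) (r κ))).real
        (badRandomness Prot κ T (D κ) (Z κ) (A κ) wf c (4 * δ₁ / (1 - φ)) (r κ))
  rcases Nat.eq_zero_or_pos (T.card * Prot.q) with h0 | h0
  · have : 0 ≤ 4 * δ₁ / (1 - φ) :=
      div_nonneg (mul_nonneg (by norm_num) hδ₁.1.le) (sub_pos.2 hφ.2).le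
    simp only [badRandomness_eq_empty Prot _ T _ _ _ hT hwf.le hc h0 this, measureReal_empty]
    exact Asymptotics.superpolynomialDecay_zero _ _
  have hq : 0 < Prot.q := Nat.pos_of_mul_pos_left h0
  have hnq : (0 : ℝ) < 2 * (Prot.n * Prot.q) := by positivity
  -- Any slot would do. That `p < 1` comes from `p < pf ≤ 1`.
  have hu := onlyBlockProb_pos Prot hp (hpf.trans_le Prot.pf.2.2) (⟨0, hn⟩, ⟨0, hq⟩)
  have hdecay := ((hr.superpolynomialDecay_mul (superpolynomialDecay_exp_neg hu)).add
    ((hr.superpolynomialDecay_exp_neg (mul_pos hu (half_pos hδ₁.1))).const_mul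
      (Real.exp (onlyBlockProb Prot (⟨0, hn⟩, ⟨0, hq⟩))))).add
    ((hr.superpolynomialDecay_exp_neg (div_pos (pow_pos (mul_pos hδ₁.1 hpf') 2) hnq)).const_mul 2)
  refine hdecay.trans_eventually_abs_le ?_
  filter_upwards [Filter.eventually_ge_atTop 2] with κ hκ
  have hrκ : 0 < r κ := by
    obtain ⟨P, -, hP⟩ := hr
    exact Nat.pos_of_ne_zero (hP κ (by omega)).2
  rw [Function.comp_apply, Function.comp_apply, abs_of_nonneg measureReal_nonneg]
  exact (measureReal_badRandomness_le Prot κ T (D κ) (Z κ) (A κ) hT hR hκ hφ.2 hδ₁.1 hδ hwf hpf' hc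
    hca hcδ h0 (⟨0, hn⟩, ⟨0, hq⟩) hrκ).trans (le_abs_self _)
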